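/- For $\theta>0$ let $D_\theta$ denote a random variable having the Dickman distribution with parameter $\theta$, i.e. the unique distribution on $[0,\infty)$ of a random variable $W$ such that $W$ and $U^{1/\theta}(W+1)$ have the same distribution, where $U$ is uniformly distributed on $[0,1]$ and independent of $W$. For non-negative random variables $X,Y$ let $d_K(X,Y)=\sup_{a\ge 0}|\mathbf P(X\le a)-\mathbf P(Y\le a)|$ be the Kolmogorov distance. **Theorem.** For $\theta>0$, $\beta\in\mathbb R$ and $n,l\in\mathbb N=\{1,2,\dots\}$ with $n\ge l>-\beta$, let $W_n=n^{-1}\sum_{k=l}^n kP_k$, where $P_l,\dots,P_n$ are independent and $P_k$ has the Poisson distribution with mean $\theta/(k+\beta)$. Then there exists a constant $C\in(0,\infty)$ depending only on $\theta$ and $\beta$ such that $$ d_K(W_n,D_\theta)\le \begin{cases} C\left(\dfrac{l+|\beta|\log(n/l)}{n}\right), & \theta\ge 1,\\[2mm] \dfrac{C\,l^\theta}{n^\theta}, & \theta\in(0,1). \end{cases} $$ Moreover, the bound is of optimal order in $n$, that is, there exists a constant $C'\in(0,\infty)$ depending only on $\theta$, $\beta$ and $l$ such that $$ d_K(W_n,D_\theta)\ge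 \begin{cases} C'\left(\dfrac{1+|\beta|\log n}{n}\right), & \theta\ge 1,\\[2mm] \dfrac{C'}{n^\theta}, & \theta\in(0,1). \end{cases} $$ -/

import Mathlib

open MeasureTheory ProbabilityTheory

/-- The uniform distribution `U[0,1]`, as a measure on `ℝ`. -/
noncomputable def uniform01 : Measure ℝ := volume.restrict (Set.Icc 0 1)

instance uniform01_isProbabilityMeasure : IsProbabilityMeasure uniform01 :=
  ⟨by simp [uniform01]⟩

/-- The distribution of `U ^ (1/θ) * (W + 1)`, where `U` is uniform on `[0,1]`, `W` has
distribution `μ`, and `U` and `W` are independent. -/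
noncomputable def dickmanTransform (θ : ℝ) (μ : Measure ℝ) : Measure ℝ :=
  (uniform01.prod μ).map (fun p : ℝ × ℝ => p.1 ^ (1 / θ) * (p.2 + 1))

/-- `μ` is the distribution of a non-negative random variable and a fixed point of the
transformation `W ↦ U ^ (1/θ) * (W + 1)`. -/
structure IsDickman (θ : ℝ) (μ : Measure ℝ) : Prop where
  isProbabilityMeasure : IsProbabilityMeasure μ
  nonneg : ∀ᵐ x ∂μ, 0 ≤ x
  fixed : dickmanTransform θ μ = μ

/-! ### There is exactly one such fixed point -/

/-- Prepend a number to a sequence. -/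
def seqCons (p : ℝ × (ℕ → ℝ)) : ℕ → ℝ
  | 0 => p.1
  | n + 1 => p.2 n

theorem measurable_seqCons : Measurable seqCons := by
  refine measurable_pi_lambda _ fun n => ?_
  cases n with
  | zero => exact measurable_fst
  | succ n => exact (measurable_pi_apply n).comp measurable_snd

/-- The distribution of a sequence of independent uniform random variables. -/
noncomputable def uniformSeq : Measure (ℕ → ℝ) := Measure.infinitePi fun _ => uniform01

instance uniformSeq_isProbabilityMeasure : IsProbabilityMeasure uniformSeq := by
  unfold uniformSeq; infer_instance

theorem map_seqCons : (uniform01.prod uniformSeq).map seqCons = uniformSeq := by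
  classical
  refine Measure.eq_infinitePi _ fun s t ht => ?_
  let s' : Finset ℕ := (s.erase 0).image Nat.pred
  have hs' : ∀ n, n ∈ s' ↔ n + 1 ∈ s := by
    intro n
    simp only [s', Finset.mem_image, Finset.mem_erase]
    constructor
    · rintro ⟨a, ⟨ha, has⟩, rfl⟩
      cases a with
      | zero => exact absurd rfl ha
      | succ a => simpa using has
    · intro h
      exact ⟨n + 1, ⟨by simp, h⟩, rfl⟩
  let t0 : Set ℝ := if 0 ∈ s then t 0 else Set.univ
  have hpre : seqCons ⁻¹' (Set.pi s t) = t0 ×ˢ (Set.pi s' fun n => t (n + 1)) := by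
    ext p
    simp only [Set.mem_preimage, Set.mem_pi, Set.mem_prod, SetLike.mem_coe, t0]
    constructor
    · intro h
      refine ⟨?_, fun n hn => h (n + 1) ((hs' n).1 hn)⟩
      split_ifs with h0
      · exact h 0 h0
      · trivial
    · rintro ⟨h0, h1⟩ n hn
      cases n with
      | zero => rw [if_pos hn] at h0; exact h0
      | succ n => exact h1 n ((hs' n).2 hn)
  rw [Measure.map_apply measurable_seqCons
    (MeasurableSet.pi s.countable_toSet fun i _ => ht i), hpre, Measure.prod_prod, uniformSeq,
    Measure.infinitePi_pi _ (fun i _ => ht (i + 1))]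
  have himg : s.erase 0 = s'.image Nat.succ := by
    ext n
    cases n with
    | zero => simp
    | succ n => simp [hs']
  have hprod : ∏ n ∈ s', uniform01 (t (n + 1)) = ∏ n ∈ s.erase 0, uniform01 (t n) := by
    rw [himg, Finset.prod_image (fun a _ b _ h => Nat.succ_injective h)]
  rw [hprod]
  by_cases h0 : 0 ∈ s
  · simp only [t0, if_pos h0]
    exact Finset.mul_prod_erase s (fun n => uniform01 (t n)) h0
  · simp only [t0, if_neg h0, measure_univ, one_mul, Finset.erase_eq_of_notMem h0]

/-- The perpetuity `∑ₖ (U₀ ⋯ Uₖ) ^ (1/θ)`, with values in `[0,∞]`. -/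
noncomputable def perpetuity (θ : ℝ) (ω : ℕ → ℝ) : ENNReal :=
  ∑' k : ℕ, ∏ i ∈ Finset.range (k + 1), ENNReal.ofReal (ω i ^ (1 / θ))

theorem measurable_perpetuity (θ : ℝ) : Measurable (perpetuity θ) := by
  unfold perpetuity
  fun_prop

theorem perpetuity_seqCons (θ : ℝ) (p : ℝ × (ℕ → ℝ)) :
    perpetuity θ (seqCons p) = ENNReal.ofReal (p.1 ^ (1 / θ)) * (perpetuity θ p.2 + 1) := by
  unfold perpetuity
  rw [tsum_eq_zero_add' ENNReal.summable, mul_add, ← ENNReal.tsum_mul_left, add_comm]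
  congr 1
  · refine tsum_congr fun k => ?_
    rw [Finset.prod_range_succ', mul_comm]
    rfl

theorem lintegral_uniform01_rpow {θ : ℝ} (hθ : 0 < θ) :
    ∫⁻ u, ENNReal.ofReal (u ^ (1 / θ)) ∂uniform01 = ENNReal.ofReal (1 / (1 / θ + 1)) := by
  have hp : 0 < 1 / θ := by positivity
  have hc : Continuous fun u : ℝ => u ^ (1 / θ) := Real.continuous_rpow_const hp.le
  rw [uniform01, ← ofReal_integral_eq_lintegral_ofReal
    (hc.continuousOn.integrableOn_compact isCompact_Icc)]
  · rw [integral_Icc_eq_integral_Ioc, ← intervalIntegral.integral_of_le zero_le_one,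
      integral_rpow (Or.inl (by linarith))]
    have : 1 / θ + 1 ≠ 0 := by positivity
    rw [Real.one_rpow, Real.zero_rpow this, sub_zero]
  · filter_upwards [ae_restrict_mem measurableSet_Icc] with u hu
    exact Real.rpow_nonneg hu.1 _

theorem perpetuity_ae_lt_top {θ : ℝ} (hθ : 0 < θ) :
    ∀ᵐ ω ∂uniformSeq, perpetuity θ ω < ⊤ := by
  set r : ENNReal := ENNReal.ofReal (1 / (1 / θ + 1)) with hr
  have hp : 0 < 1 / θ := by positivity
  have hr1 : r < 1 := by
    rw [hr, ← ENNReal.ofReal_one, ENNReal.ofReal_lt_ofReal_iff one_pos, div_lt_one (by linarith)]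
    linarith
  have hmeas : ∀ k : ℕ, Measurable fun ω : ℕ → ℝ =>
      ∏ i ∈ Finset.range k, ENNReal.ofReal (ω i ^ (1 / θ)) := fun k => by fun_prop
  have hI : ∀ k : ℕ, ∫⁻ ω, ∏ i ∈ Finset.range k, ENNReal.ofReal (ω i ^ (1 / θ)) ∂uniformSeq
      = r ^ k := by
    intro k
    induction k with
    | zero => simp
    | succ k ih =>
      rw [← map_seqCons, lintegral_map (hmeas _) measurable_seqCons]
      have h : ∀ p : ℝ × (ℕ → ℝ), ∏ i ∈ Finset.range (k + 1), ENNReal.ofReal (seqCons p i ^ (1 / θ))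
          = ENNReal.ofReal (p.1 ^ (1 / θ)) *
            ∏ i ∈ Finset.range k, ENNReal.ofReal (p.2 i ^ (1 / θ)) := by
        intro p
        rw [Finset.prod_range_succ', mul_comm]
        rfl
      simp_rw [h]
      rw [lintegral_prod_mul (f := fun u : ℝ => ENNReal.ofReal (u ^ (1 / θ)))
        (by fun_prop) (hmeas k).aemeasurable, ih, lintegral_uniform01_rpow hθ, pow_succ', hr]
  refine ae_lt_top (measurable_perpetuity θ) ?_
  unfold perpetuity
  rw [lintegral_tsum fun k => (hmeas (k + 1)).aemeasurable]
  simp_rw [hI, pow_succ']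
  rw [ENNReal.tsum_mul_left, ENNReal.tsum_geometric]
  refine ENNReal.mul_ne_top hr1.ne_top (ENNReal.inv_ne_top.2 ?_)
  exact (tsub_pos_of_lt hr1).ne'

theorem exists_isDickman {θ : ℝ} (hθ : 0 < θ) : ∃ μ, IsDickman θ μ := by
  have hX : Measurable fun ω => (perpetuity θ ω).toReal :=
    (measurable_perpetuity θ).ennreal_toReal
  refine ⟨uniformSeq.map fun ω => (perpetuity θ ω).toReal,
    Measure.isProbabilityMeasure_map hX.aemeasurable, ?_, ?_⟩
  · rw [ae_map_iff hX.aemeasurable measurableSet_Ici]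
    exact Filter.Eventually.of_forall fun ω => ENNReal.toReal_nonneg
  · have hT : Measurable fun p : ℝ × ℝ => p.1 ^ (1 / θ) * (p.2 + 1) := by fun_prop
    have h1 : uniform01.prod (uniformSeq.map fun ω => (perpetuity θ ω).toReal)
        = (uniform01.prod uniformSeq).map (Prod.map id fun ω => (perpetuity θ ω).toReal) := by
      rw [← Measure.map_prod_map _ _ measurable_id hX, Measure.map_id]
    rw [dickmanTransform, h1, Measure.map_map hT (measurable_id.prodMap hX)]
    conv_rhs => rw [← map_seqCons, Measure.map_map hX measurable_seqCons]
    refine Measure.map_congr ?_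
    have hfin : ∀ᵐ p ∂(uniform01.prod uniformSeq), perpetuity θ p.2 < ⊤ :=
      Measure.quasiMeasurePreserving_snd.ae (perpetuity_ae_lt_top hθ)
    have hnn : ∀ᵐ p ∂(uniform01.prod uniformSeq), 0 ≤ p.1 :=
      Measure.quasiMeasurePreserving_fst.ae (p := fun x : ℝ => 0 ≤ x) <| by
        filter_upwards [ae_restrict_mem (μ := volume) (measurableSet_Icc (a := (0 : ℝ)) (b := 1))]
          with u hu using hu.1
    filter_upwards [hfin, hnn] with p hp hp0
    simp only [Function.comp, Prod.map, id]
    rw [perpetuity_seqCons, ENNReal.toReal_mul, ENNReal.toReal_ofReal (Real.rpow_nonneg hp0 _),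
      ENNReal.toReal_add hp.ne ENNReal.one_ne_top, ENNReal.toReal_one]

theorem IsDickman.charFun_eq {θ : ℝ} {μ : Measure ℝ} (h : IsDickman θ μ) (t : ℝ) :
    charFun μ t = ∫ u, Complex.exp ((t * u ^ (1 / θ) : ℝ) * Complex.I) *
      charFun μ (t * u ^ (1 / θ)) ∂uniform01 := by
  have := h.isProbabilityMeasure
  have hT : Measurable fun p : ℝ × ℝ => p.1 ^ (1 / θ) * (p.2 + 1) := by fun_prop
  have hm : Measurable fun x : ℝ => Complex.exp (t * x * Complex.I) := by fun_prop
  conv_lhs => rw [← h.fixed]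
  rw [charFun_apply_real, dickmanTransform,
    integral_map hT.aemeasurable hm.aestronglyMeasurable, integral_prod]
  · refine integral_congr_ae (Filter.Eventually.of_forall fun u => ?_)
    simp only
    rw [charFun_apply_real, ← integral_const_mul]
    refine integral_congr_ae (Filter.Eventually.of_forall fun x => ?_)
    simp only
    rw [← Complex.exp_add]
    congr 1
    push_cast
    ring
  · refine Integrable.of_bound (hm.comp hT).aestronglyMeasurable 1
      (Filter.Eventually.of_forall fun p => ?_)
    have := Complex.norm_exp_ofReal_mul_I (t * (p.1 ^ (1 / θ) * (p.2 + 1)))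
    push_cast at this
    simpa using this.le

theorem IsDickman.eq {θ : ℝ} (hθ : 0 < θ) {μ ν : Measure ℝ} (hμ : IsDickman θ μ)
    (hν : IsDickman θ ν) : μ = ν := by
  have := hμ.isProbabilityMeasure
  have := hν.isProbabilityMeasure
  have hp : 0 < 1 / θ := by positivity
  refine Measure.ext_of_charFun (funext fun t => ?_)
  let ψ : ℝ → ℂ := fun s => charFun μ s - charFun ν s
  have hψc : Continuous ψ := continuous_charFun.sub continuous_charFun
  have hψ0 : ψ 0 = 0 := by simp [ψ]
  have hrc : Continuous fun u : ℝ => u ^ (1 / θ) := Real.continuous_rpow_const hp.le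
  have hint : ∀ g : ℝ → ℂ, Continuous g → Integrable g uniform01 := fun g hg =>
    hg.continuousOn.integrableOn_compact isCompact_Icc
  have hle : ∀ s, ‖ψ s‖ ≤ ∫ u, ‖ψ (s * u ^ (1 / θ))‖ ∂uniform01 := by
    intro s
    have hc1 : Continuous fun u : ℝ => Complex.exp ((s * u ^ (1 / θ) : ℝ) * Complex.I) := by
      fun_prop
    have hc2 : Continuous fun u : ℝ => charFun μ (s * u ^ (1 / θ)) :=
      continuous_charFun.comp (by fun_prop)
    have hc3 : Continuous fun u : ℝ => charFun ν (s * u ^ (1 / θ)) :=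
      continuous_charFun.comp (by fun_prop)
    have : ψ s = ∫ u, Complex.exp ((s * u ^ (1 / θ) : ℝ) * Complex.I) *
        ψ (s * u ^ (1 / θ)) ∂uniform01 := by
      simp only [ψ]
      rw [hμ.charFun_eq s, hν.charFun_eq s, ← integral_sub]
      · simp_rw [mul_sub]
      · exact hint _ (hc1.mul hc2)
      · exact hint _ (hc1.mul hc3)
    rw [this]
    refine (norm_integral_le_integral_norm _).trans (le_of_eq ?_)
    refine integral_congr_ae (Filter.Eventually.of_forall fun u => ?_)
    simp only
    rw [norm_mul, Complex.norm_exp_ofReal_mul_I, one_mul]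
  -- maximise `‖ψ‖` on the segment between `0` and `t`
  obtain ⟨s, hs, hmax⟩ := (isCompact_uIcc (a := (0 : ℝ)) (b := t)).exists_isMaxOn
    Set.nonempty_uIcc hψc.norm.continuousOn
  have hmem : ∀ u ∈ Set.Icc (0 : ℝ) 1, s * u ^ (1 / θ) ∈ Set.uIcc 0 t := by
    intro u hu
    have h0 : 0 ≤ u ^ (1 / θ) := Real.rpow_nonneg hu.1 _
    have h1 : u ^ (1 / θ) ≤ 1 := Real.rpow_le_one hu.1 hu.2 hp.le
    rcases Set.mem_uIcc.1 hs with h | h <;> rw [Set.mem_uIcc]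
    · exact Or.inl ⟨by nlinarith, by nlinarith⟩
    · exact Or.inr ⟨by nlinarith, by nlinarith⟩
  let g : ℝ → ℝ := fun u => ‖ψ s‖ - ‖ψ (s * u ^ (1 / θ))‖
  have hc : Continuous fun u : ℝ => ‖ψ (s * u ^ (1 / θ))‖ :=
    (hψc.comp (continuous_const.mul hrc)).norm
  have hgc : Continuous g := continuous_const.sub hc
  have hg0 : ∀ u ∈ Set.Icc (0 : ℝ) 1, 0 ≤ g u := fun u hu => sub_nonneg.2 (hmax (hmem u hu))
  have hgi : ∫ u in (0 : ℝ)..1, g u ≤ 0 := by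
    rw [intervalIntegral.integral_sub (by simp) (hc.intervalIntegrable _ _)]
    have h := hle s
    rw [uniform01, integral_Icc_eq_integral_Ioc,
      ← intervalIntegral.integral_of_le zero_le_one] at h
    simp only [intervalIntegral.integral_const, sub_zero, one_smul]
    linarith
  have hs0 : ‖ψ s‖ ≤ 0 := by
    by_contra hcon
    have hpos : 0 < ∫ u in (0 : ℝ)..1, g u := by
      refine intervalIntegral.integral_pos one_pos hgc.continuousOn
        (fun u hu => hg0 u ⟨hu.1.le, hu.2⟩) ⟨0, by simp, ?_⟩
      simp only [g, Real.zero_rpow hp.ne', mul_zero, hψ0, norm_zero, sub_zero]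
      exact not_le.1 hcon
    linarith
  have ht : ‖ψ t‖ ≤ 0 := (hmax Set.right_mem_uIcc).trans hs0
  exact sub_eq_zero.1 (norm_le_zero_iff.1 ht)

theorem existsUnique_isDickman {θ : ℝ} (hθ : 0 < θ) : ∃! μ, IsDickman θ μ := by
  obtain ⟨μ, hμ⟩ := exists_isDickman hθ
  exact ⟨μ, hμ, fun ν hν => hν.eq hθ hμ⟩

/-! ### The notions of the theorem -/

open Classical in
/-- The Dickman distribution with parameter `θ > 0`, that is, the unique distribution of a
non-negative random variable `W` such that `W` and `U ^ (1/θ) * (W + 1)` have the same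
distribution (with the value `0` for `θ ≤ 0`, which is not used). -/
noncomputable def dickman (θ : ℝ) : Measure ℝ :=
  if hθ : 0 < θ then (existsUnique_isDickman hθ).choose else 0

theorem isDickman_dickman {θ : ℝ} (hθ : 0 < θ) : IsDickman θ (dickman θ) := by
  rw [dickman, dif_pos hθ]
  exact (existsUnique_isDickman hθ).choose_spec.1

/-- The Kolmogorov distance between two probability distributions on `[0,∞)`: the supremum over
`a ≥ 0` of the distance of the distribution functions at `a`. -/
noncomputable def kolmogorovDist (μ ν : Measure ℝ) : ℝ :=
  ⨆ a : Set.Ici (0 : ℝ), |μ.real (Set.Iic (a : ℝ)) - ν.real (Set.Iic (a : ℝ))|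

/-- The supremum in the definition of the Kolmogorov distance is finite. -/
theorem bddAbove_kolmogorovDist (μ ν : Measure ℝ) [IsProbabilityMeasure μ]
    [IsProbabilityMeasure ν] : BddAbove (Set.range fun a : Set.Ici (0 : ℝ) =>
      |μ.real (Set.Iic (a : ℝ)) - ν.real (Set.Iic (a : ℝ))|) := by
  refine ⟨1, ?_⟩
  rintro _ ⟨a, rfl⟩
  exact abs_sub_le_of_le_of_le measureReal_nonneg measureReal_le_one measureReal_nonneg
    measureReal_le_one |>.trans (by norm_num)

/-- The random variables `P_l, …, P_n` are independent, and `P_k` has the Poisson distribution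
with mean `θ / (k + β)`. -/
structure IsPoissonFamily {Ω : Type*} [MeasurableSpace Ω] (Pr : Measure Ω) (θ β : ℝ) (l n : ℕ)
    (P : ℕ → Ω → ℕ) : Prop where
  hasLaw : ∀ k ∈ Finset.Icc l n, HasLaw (P k) (poissonMeasure (θ / (k + β)).toNNReal) Pr
  indep : iIndepFun (fun k : Finset.Icc l n => P k) Pr

/-- The weighted sum `W_n = n⁻¹ ∑_{k=l}^n k P_k`. -/
noncomputable def weightedSum {Ω : Type*} (l n : ℕ) (P : ℕ → Ω → ℕ) (ω : Ω) : ℝ :=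
  (n : ℝ)⁻¹ * ∑ k ∈ Finset.Icc l n, (k : ℝ) * (P k ω : ℝ)

/-! Upper bound. Stein's method is run at the level of distribution functions. Let `T` be the
Dickman transform and, for `x > 0`, let `f_x` be `cutPower θ x`. Direct integration gives `Tμ(x) -
μ(x) = E[W f_x(W) - θ ∫₀¹ f_x(W + u) du]` (`dickmanTransform_real_Iic_sub`). The Poisson size-bias
identity turns `E[W f_x(W)]` into `θ ∑ (k/n)/(k+β) E f_x(W + k/n)`. Since `k/(k+β) = 1 - β/(k+β)`,
the defect consists of a Riemann sum error, the missing terms `k < l`, and a `β`-term of harmonic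
type (`abs_dickmanTransform_sub_le`).

The size of `E f_x` is governed by `f_x(w) ≤ x^θ max(x,w)^(-θ-1)` and by `P(W ≤ y) ≤ C y^θ` for `y ≥
l/n`, which holds because `W ≤ y` forces `P_k = 0` for all `k > ny`. This gives order `x^(θ-1)` on
`[l/n, 1]`: bounded if `θ ≥ 1`, and at most `(l/n)^(θ-1)` if `θ < 1`. Below `l/n` both distribution
functions are `O((l/n)^θ)`.

A small defect implies a small distance because `T` acts on differences of distribution functions as
a strict contraction in a sup norm weighted by a function decaying like `1/x`
(`exists_contracting_weight`, `exists_kolmogorov_bound`).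

Lower bound. The Dickman law has no atom at `0`, while `P(W = 0) = exp(-θ ∑ 1/(k+β))` is of order
`n^(-θ)`. For the order `(1 + |β| log n)/n`, the two laws are compared on the smooth function `(w -
c) e^(-w)`, with `c` chosen so that its Dickman mean vanishes. Its mean under `W` is explicit, up to
a factor bounded below, and is of the claimed order (`exists_weighted_exp_sum_lower_bound`). -/

/-! ### Poisson variables: the Chen identity. -/

/-- The weights satisfy `(j+1) p(j+1) = r p(j)`, so shifting the series by one proves it. -/
theorem lintegral_natCast_mul_poissonMeasure (r : NNReal) (g : ℕ → ENNReal) :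
    ∫⁻ j, (j : ENNReal) * g j ∂(poissonMeasure r) = r * ∫⁻ j, g (j + 1) ∂(poissonMeasure r) := by
  rw [lintegral_countable', lintegral_countable', tsum_eq_zero_add' ENNReal.summable,
    ← ENNReal.tsum_mul_left]
  simp only [Nat.cast_zero, zero_mul, zero_add]
  refine tsum_congr fun j => ?_
  have h : ((j + 1 : ℕ) : ENNReal) * poissonMeasure r {j + 1} = r * poissonMeasure r {j} := by
    rw [poissonMeasure_singleton, poissonMeasure_singleton, ← ENNReal.ofReal_natCast,
      ← ENNReal.ofReal_coe_nnreal, ← ENNReal.ofReal_mul (by positivity),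
      ← ENNReal.ofReal_mul (by positivity)]
    congr 1
    rw [Nat.factorial_succ]
    push_cast
    rw [pow_succ]
    field_simp
  calc ((j + 1 : ℕ) : ENNReal) * g (j + 1) * poissonMeasure r {j + 1}
      = (((j + 1 : ℕ) : ENNReal) * poissonMeasure r {j + 1}) * g (j + 1) := by ring
    _ = r * (g (j + 1) * poissonMeasure r {j}) := by rw [h]; ring

theorem lintegral_poisson_mul_of_indepFun {Ω : Type*} [MeasurableSpace Ω] {Pr : Measure Ω}
    [IsProbabilityMeasure Pr] {r : NNReal} {X : Ω → ℕ} {Y : Ω → ℝ}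
    (hX : HasLaw X (poissonMeasure r) Pr) (hY : AEMeasurable Y Pr) (hXY : IndepFun X Y Pr)
    (c : ℝ) {f : ℝ → ENNReal} (hf : Measurable f) :
    ∫⁻ ω, (X ω : ENNReal) * f (c * X ω + Y ω) ∂Pr
      = r * ∫⁻ ω, f (c * X ω + Y ω + c) ∂Pr := by
  have hlaw : Pr.map (fun ω => (X ω, Y ω)) = (poissonMeasure r).prod (Pr.map Y) := by
    rw [(indepFun_iff_map_prod_eq_prod_map_map hX.aemeasurable hY).1 hXY, hX.map_eq]
  have hXY' : AEMeasurable (fun ω => (X ω, Y ω)) Pr := hX.aemeasurable.prodMk hY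
  have : IsProbabilityMeasure (Pr.map Y) := Measure.isProbabilityMeasure_map hY
  have hm1 : Measurable fun p : ℕ × ℝ => (p.1 : ENNReal) * f (c * p.1 + p.2) := by
    fun_prop
  have hm2 : Measurable fun p : ℕ × ℝ => f (c * p.1 + p.2 + c) := by
    fun_prop
  have h1 : ∫⁻ ω, (X ω : ENNReal) * f (c * X ω + Y ω) ∂Pr
      = ∫⁻ p, (p.1 : ENNReal) * f (c * p.1 + p.2) ∂((poissonMeasure r).prod (Pr.map Y)) := by
    rw [← hlaw, lintegral_map' hm1.aemeasurable hXY']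
  have h2 : ∫⁻ ω, f (c * X ω + Y ω + c) ∂Pr
      = ∫⁻ p, f (c * p.1 + p.2 + c) ∂((poissonMeasure r).prod (Pr.map Y)) := by
    rw [← hlaw, lintegral_map' hm2.aemeasurable hXY']
  rw [h1, h2, lintegral_prod_symm _ hm1.aemeasurable, lintegral_prod_symm _ hm2.aemeasurable,
    ← lintegral_const_mul _ hm2.lintegral_prod_left']
  refine lintegral_congr fun y => ?_
  rw [lintegral_natCast_mul_poissonMeasure]
  congr 1
  refine lintegral_congr fun j => ?_
  congr 1
  push_cast
  ring

/-! ### The weighted Poisson sum: size-bias identity and vanishing of summands. -/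

theorem weightedSum_nonneg {Ω : Type*} (l n : ℕ) (P : ℕ → Ω → ℕ) (ω : Ω) :
    0 ≤ weightedSum l n P ω := by
  unfold weightedSum
  positivity

namespace IsPoissonFamily

variable {Ω : Type*} [MeasurableSpace Ω] {Pr : Measure Ω} {θ β : ℝ} {l n : ℕ} {P : ℕ → Ω → ℕ}

theorem aemeasurable (h : IsPoissonFamily Pr θ β l n P) {k : ℕ} (hk : k ∈ Finset.Icc l n) :
    AEMeasurable (P k) Pr := (h.hasLaw k hk).aemeasurable

theorem aemeasurable_weightedSum (h : IsPoissonFamily Pr θ β l n P) :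
    AEMeasurable (weightedSum l n P) Pr := by
  unfold weightedSum
  refine AEMeasurable.const_mul (Finset.aemeasurable_fun_sum _ fun k hk => ?_) _
  exact ((measurable_from_nat (f := fun j : ℕ => (j : ℝ))).comp_aemeasurable
    (h.aemeasurable hk)).const_mul _

/-- The remainder after removing the `k`-th term depends on the other coordinates only; this is what
allows the Chen identity to be applied one summand at a time. -/
theorem indepFun_sub (h : IsPoissonFamily Pr θ β l n P) {k : ℕ} (hk : k ∈ Finset.Icc l n) :
    IndepFun (P k) (fun ω => weightedSum l n P ω - (k / n : ℝ) * P k ω) Pr := by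
  classical
  let k' : Finset.Icc l n := ⟨k, hk⟩
  have hI := h.indep.indepFun_finset₀ {k'} (Finset.univ.erase k')
    (by simp) (fun i => h.aemeasurable i.2)
  let φ : (({k'} : Finset (Finset.Icc l n)) → ℕ) → ℕ := fun a => a ⟨k', by simp⟩
  let ψ : (↥(Finset.univ.erase k') → ℕ) → ℝ :=
    fun a => (n : ℝ)⁻¹ * ∑ i, ((i.1 : ℕ) : ℝ) * (a i : ℝ)
  have hφ : Measurable φ := measurable_pi_apply _
  have hψ : Measurable ψ := by
    refine Measurable.const_mul (Finset.measurable_fun_sum _ fun i _ => ?_) _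
    exact ((measurable_from_nat (f := fun j : ℕ => (j : ℝ))).comp
      (measurable_pi_apply i)).const_mul _
  suffices hrest : (fun ω => weightedSum l n P ω - (k / n : ℝ) * P k ω) =
      ψ ∘ fun ω (i : ↥(Finset.univ.erase k')) => P i ω from hrest ▸ hI.comp hφ hψ
  funext ω
  simp only [ψ, Function.comp, weightedSum]
  rw [Finset.sum_coe_sort (Finset.univ.erase k')
    (fun i : Finset.Icc l n => ((i : ℕ) : ℝ) * (P i ω : ℝ)),
    Finset.sum_erase_eq_sub (Finset.mem_univ _),
    Finset.sum_coe_sort (Finset.Icc l n) (fun i : ℕ => (i : ℝ) * (P i ω : ℝ))]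
  simp only [k']
  ring

/-- The size-bias identity of the weighted Poisson sum. -/
theorem lintegral_mul (h : IsPoissonFamily Pr θ β l n P) [IsProbabilityMeasure Pr]
    {f : ℝ → ENNReal} (hf : Measurable f) :
    ∫⁻ w, ENNReal.ofReal w * f w ∂(Pr.map (weightedSum l n P)) =
      ∑ k ∈ Finset.Icc l n, ENNReal.ofReal (k / n) * ENNReal.ofReal (θ / (k + β)) *
        ∫⁻ w, f (w + k / n) ∂(Pr.map (weightedSum l n P)) := by
  have hW := h.aemeasurable_weightedSum
  rw [lintegral_map' (by fun_prop) hW]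
  have hexp : ∀ ω, ENNReal.ofReal (weightedSum l n P ω) * f (weightedSum l n P ω) =
      ∑ k ∈ Finset.Icc l n, ENNReal.ofReal (k / n) *
        ((P k ω : ENNReal) * f (weightedSum l n P ω)) := by
    intro ω
    have : weightedSum l n P ω = ∑ k ∈ Finset.Icc l n, (k / n : ℝ) * P k ω := by
      rw [weightedSum, Finset.mul_sum]
      exact Finset.sum_congr rfl fun k _ => by ring
    conv_lhs => rw [this]
    rw [ENNReal.ofReal_sum_of_nonneg (fun k _ => by positivity), Finset.sum_mul, ← this]
    refine Finset.sum_congr rfl fun k _ => ?_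
    rw [ENNReal.ofReal_mul (by positivity), ENNReal.ofReal_natCast, mul_assoc]
  simp_rw [hexp]
  have hP : ∀ k ∈ Finset.Icc l n, AEMeasurable (fun ω => (P k ω : ENNReal)) Pr := fun k hk =>
    (measurable_from_nat (f := fun j : ℕ => (j : ENNReal))).comp_aemeasurable (h.aemeasurable hk)
  have hfW : AEMeasurable (fun ω => f (weightedSum l n P ω)) Pr := hf.comp_aemeasurable hW
  have hPW : ∀ k ∈ Finset.Icc l n,
      AEMeasurable (fun ω => (P k ω : ENNReal) * f (weightedSum l n P ω)) Pr :=
    fun k hk => (hP k hk).mul hfW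
  rw [lintegral_finsetSum' _ fun k hk => (hPW k hk).const_mul _]
  refine Finset.sum_congr rfl fun k hk => ?_
  rw [lintegral_const_mul'' _ (hPW k hk), lintegral_map' (by fun_prop) hW, mul_assoc]
  congr 1
  have hY : AEMeasurable (fun ω => weightedSum l n P ω - (k / n : ℝ) * P k ω) Pr :=
    hW.sub (((measurable_from_nat (f := fun j : ℕ => (j : ℝ))).comp_aemeasurable
      (h.aemeasurable hk)).const_mul _)
  have := lintegral_poisson_mul_of_indepFun (h.hasLaw k hk) hY (h.indepFun_sub hk) (k / n : ℝ) hf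
  simp only [add_sub_cancel] at this
  exact this

theorem integrable_integral_mul (h : IsPoissonFamily Pr θ β l n P) [IsProbabilityMeasure Pr]
    (hθ : 0 < θ) (hβ : -β < (l : ℝ))
    {f : ℝ → ℝ} (hf : Measurable f) (hf0 : ∀ y, 0 ≤ f y)
    {M : ℝ} (hfM : ∀ y, 0 ≤ y → f y ≤ M) :
    Integrable (fun w => w * f w) (Pr.map (weightedSum l n P)) ∧
    ∫ w, w * f w ∂(Pr.map (weightedSum l n P)) =
      ∑ k ∈ Finset.Icc l n, (k / n : ℝ) * (θ / (k + β)) *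
        ∫ w, f (w + k / n) ∂(Pr.map (weightedSum l n P)) := by
  have hW := h.aemeasurable_weightedSum
  have : IsProbabilityMeasure (Pr.map (weightedSum l n P)) := Measure.isProbabilityMeasure_map hW
  have hnn : ∀ᵐ w ∂(Pr.map (weightedSum l n P)), 0 ≤ w := by
    rw [ae_map_iff hW measurableSet_Ici]
    exact Filter.Eventually.of_forall (weightedSum_nonneg l n P)
  have hint : ∀ k : ℕ, Integrable (fun w => f (w + k / n)) (Pr.map (weightedSum l n P)) := by
    intro k
    refine Integrable.of_bound
      (hf.comp (measurable_id.add_const _)).aestronglyMeasurable M ?_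
    filter_upwards [hnn] with w hw
    rw [Real.norm_of_nonneg (hf0 _)]
    exact hfM _ (by positivity)
  have key := h.lintegral_mul (f := fun y => ENNReal.ofReal (f y)) (by fun_prop)
  have hpos : ∀ k ∈ Finset.Icc l n, 0 ≤ θ / (k + β) := by
    intro k hk
    have : (l : ℝ) ≤ k := by exact_mod_cast (Finset.mem_Icc.1 hk).1
    have : 0 < (k : ℝ) + β := by linarith
    positivity
  have hR : ∑ k ∈ Finset.Icc l n, ENNReal.ofReal (k / n) * ENNReal.ofReal (θ / (k + β)) *
        ∫⁻ w, ENNReal.ofReal (f (w + k / n)) ∂(Pr.map (weightedSum l n P)) =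
      ENNReal.ofReal (∑ k ∈ Finset.Icc l n, (k / n : ℝ) * (θ / (k + β)) *
        ∫ w, f (w + k / n) ∂(Pr.map (weightedSum l n P))) := by
    rw [ENNReal.ofReal_sum_of_nonneg]
    · refine Finset.sum_congr rfl fun k hk => ?_
      have := hpos k hk
      rw [ENNReal.ofReal_mul (by positivity), ENNReal.ofReal_mul (by positivity),
        ofReal_integral_eq_lintegral_ofReal (hint k) (Filter.Eventually.of_forall fun _ => hf0 _)]
    · intro k hk
      have := hpos k hk
      have : 0 ≤ ∫ w, f (w + k / n) ∂(Pr.map (weightedSum l n P)) :=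
        integral_nonneg fun _ => hf0 _
      positivity
  have hL : ∫⁻ w, ENNReal.ofReal w * ENNReal.ofReal (f w) ∂(Pr.map (weightedSum l n P)) =
      ∫⁻ w, ENNReal.ofReal (w * f w) ∂(Pr.map (weightedSum l n P)) := by
    refine lintegral_congr_ae ?_
    filter_upwards [hnn] with w hw
    rw [ENNReal.ofReal_mul hw]
  have hnn' : 0 ≤ᵐ[Pr.map (weightedSum l n P)] fun w => w * f w := by
    filter_upwards [hnn] with w hw using mul_nonneg hw (hf0 w)
  rw [hR, hL] at key
  refine ⟨(lintegral_ofReal_ne_top_iff_integrable (by fun_prop) hnn').1 (by simp [key]), ?_⟩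
  rw [integral_eq_lintegral_of_nonneg_ae hnn' (by fun_prop), key, ENNReal.toReal_ofReal]
  refine Finset.sum_nonneg fun k hk => ?_
  have := hpos k hk
  have : 0 ≤ ∫ w, f (w + k / n) ∂(Pr.map (weightedSum l n P)) :=
    integral_nonneg fun _ => hf0 _
  positivity

theorem measureReal_forall_eq_zero (h : IsPoissonFamily Pr θ β l n P)
    (hθ : 0 < θ) (hβ : -β < (l : ℝ)) {s : Finset ℕ} (hs : s ⊆ Finset.Icc l n) :
    Pr.real {ω | ∀ k ∈ s, P k ω = 0} = Real.exp (-∑ k ∈ s, θ / (k + β)) := by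
  classical
  let t : Finset (Finset.Icc l n) := Finset.univ.filter fun i => (i : ℕ) ∈ s
  have hset : {ω | ∀ k ∈ s, P k ω = 0} = ⋂ i ∈ t, P i ⁻¹' {0} := by
    ext ω
    simp only [Set.mem_ofPred_eq, Set.mem_iInter, Set.mem_preimage, Set.mem_singleton_iff, t,
      Finset.mem_filter, Finset.mem_univ, true_and]
    exact ⟨fun H i hi => H i hi, fun H k hk => H ⟨k, hs hk⟩ hk⟩
  rw [hset, measureReal_def, h.indep.measure_inter_preimage_eq_mul t (fun _ _ => .of_discrete),
    ENNReal.toReal_prod, ← Finset.sum_neg_distrib, Real.exp_sum]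
  have hterm : ∀ k ∈ Finset.Icc l n, (Pr (P k ⁻¹' {0})).toReal = Real.exp (-(θ / (k + β))) := by
    intro k hk
    have hk' : (l : ℝ) ≤ k := by exact_mod_cast (Finset.mem_Icc.1 hk).1
    have : 0 < (k : ℝ) + β := by linarith
    have h0 : 0 ≤ θ / (k + β) := by positivity
    rw [← Measure.map_apply_of_aemeasurable (h.aemeasurable hk) (by simp),
      (h.hasLaw k hk).map_eq, ← measureReal_def, poissonMeasure_real_singleton]
    simp [Real.coe_toNNReal _ h0]
  rw [Finset.prod_congr rfl fun (i : Finset.Icc l n) _ => hterm i i.2]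
  refine Finset.prod_bij (fun i _ => (i : ℕ)) (fun i hi => by simpa [t] using hi)
    (fun i _ j _ hij => Subtype.ext hij) (fun k hk => ⟨⟨k, hs hk⟩, by simpa [t] using hk, rfl⟩)
    fun _ _ => rfl

/-- A single nonzero `P_k` with `k ≥ m` already makes the sum at least `m/n > x`, so the event
forces all these variables to vanish. -/
theorem measureReal_Iic_le (h : IsPoissonFamily Pr θ β l n P) [IsProbabilityMeasure Pr]
    (hθ : 0 < θ) (hβ : -β < (l : ℝ)) (hn : 1 ≤ n) {m : ℕ} (hlm : l ≤ m) {x : ℝ}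
    (hx : n * x < m) :
    (Pr.map (weightedSum l n P)).real (Set.Iic x) ≤
      Real.exp (-∑ k ∈ Finset.Icc m n, θ / (k + β)) := by
  have hs : Finset.Icc m n ⊆ Finset.Icc l n := Finset.Icc_subset_Icc_left hlm
  rw [← h.measureReal_forall_eq_zero hθ hβ hs, measureReal_def,
    Measure.map_apply_of_aemeasurable h.aemeasurable_weightedSum measurableSet_Iic,
    ← measureReal_def]
  refine measureReal_mono fun ω hω k hk => ?_
  by_contra hne
  have hn' : (0 : ℝ) < n := by exact_mod_cast hn
  have h1 : (1 : ℝ) ≤ P k ω := by exact_mod_cast Nat.one_le_iff_ne_zero.2 hne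
  have h2 : (k : ℝ) * P k ω ≤ ∑ j ∈ Finset.Icc l n, (j : ℝ) * (P j ω : ℝ) :=
    Finset.single_le_sum (f := fun j : ℕ => (j : ℝ) * (P j ω : ℝ))
      (fun j _ => by positivity) (hs hk)
  have h3 : (m : ℝ) ≤ k := by exact_mod_cast (Finset.mem_Icc.1 hk).1
  have h4 : ∑ j ∈ Finset.Icc l n, (j : ℝ) * (P j ω : ℝ) ≤ n * x := by
    have : weightedSum l n P ω ≤ x := hω
    rw [weightedSum, inv_mul_le_iff₀ hn'] at this
    exact this
  have h5 : (0 : ℝ) ≤ k := by positivity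
  nlinarith

theorem measureReal_Iic_zero (h : IsPoissonFamily Pr θ β l n P) [IsProbabilityMeasure Pr]
    (hθ : 0 < θ) (hβ : -β < (l : ℝ)) :
    Real.exp (-∑ k ∈ Finset.Icc l n, θ / (k + β)) ≤
      (Pr.map (weightedSum l n P)).real (Set.Iic 0) := by
  rw [← h.measureReal_forall_eq_zero hθ hβ (Finset.Subset.refl _), measureReal_def (Pr.map _),
    Measure.map_apply_of_aemeasurable h.aemeasurable_weightedSum measurableSet_Iic,
    ← measureReal_def]
  refine measureReal_mono fun ω hω => ?_
  have : weightedSum l n P ω = 0 := by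
    rw [weightedSum, Finset.sum_eq_zero fun k hk => by rw [hω k hk]; simp, mul_zero]
  exact this.le

end IsPoissonFamily

/-! ### Distribution function of the Dickman transform. -/

theorem measurable_dickmanMap (θ : ℝ) :
    Measurable fun p : ℝ × ℝ => p.1 ^ (1 / θ) * (p.2 + 1) := by fun_prop

theorem uniform01_ae_mem_Ioc : ∀ᵐ u ∂uniform01, u ∈ Set.Ioc (0 : ℝ) 1 := by
  rw [uniform01, Measure.restrict_congr_set Ioc_ae_eq_Icc.symm]
  exact ae_restrict_mem measurableSet_Ioc

/-- Conditioning on the uniform variable: this exhibits the transform as a linear operator on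
distribution functions, the form needed for the contraction argument. The point `u = 0`, where the
quotient takes a default value, is a null set. -/
theorem dickmanTransform_real_Iic (θ : ℝ) (μ : Measure ℝ) [IsProbabilityMeasure μ] (x : ℝ) :
    Integrable (fun u => μ.real (Set.Iic (x / u ^ (1 / θ) - 1))) uniform01 ∧
    (dickmanTransform θ μ).real (Set.Iic x) =
      ∫ u, μ.real (Set.Iic (x / u ^ (1 / θ) - 1)) ∂uniform01 := by
  have hs : MeasurableSet ((fun p : ℝ × ℝ => p.1 ^ (1 / θ) * (p.2 + 1)) ⁻¹' Set.Iic x) :=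
    measurable_dickmanMap θ measurableSet_Iic
  have hae : ∀ᵐ u ∂uniform01, μ (Prod.mk u ⁻¹'
      ((fun p : ℝ × ℝ => p.1 ^ (1 / θ) * (p.2 + 1)) ⁻¹' Set.Iic x)) =
      μ (Set.Iic (x / u ^ (1 / θ) - 1)) := by
    filter_upwards [uniform01_ae_mem_Ioc] with u hu
    congr 1
    ext w
    have : 0 < u ^ (1 / θ) := Real.rpow_pos_of_pos hu.1 _
    simp only [Set.mem_preimage, Set.mem_Iic]
    rw [le_sub_iff_add_le, le_div_iff₀ this, mul_comm]
  have hm : AEMeasurable (fun u => μ (Set.Iic (x / u ^ (1 / θ) - 1))) uniform01 :=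
    (measurable_measure_prodMk_left hs).aemeasurable.congr hae
  refine ⟨Integrable.of_bound hm.ennreal_toReal.aestronglyMeasurable 1
    (Filter.Eventually.of_forall fun u => ?_), ?_⟩
  · rw [Real.norm_of_nonneg (by positivity)]
    exact measureReal_le_one
  · simp only [measureReal_def]
    rw [dickmanTransform, Measure.map_apply (measurable_dickmanMap θ) measurableSet_Iic,
      Measure.prod_apply hs, lintegral_congr_ae hae, integral_toReal hm]
    exact Filter.Eventually.of_forall fun u => measure_lt_top _ _

theorem uniform01_rpow_mul_le {θ x y : ℝ} (hθ : 0 < θ) (hx : 0 < x) (hy : 0 < y) :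
    uniform01 {u | u ^ (1 / θ) * y ≤ x} = ENNReal.ofReal (x ^ θ * max x y ^ (-θ)) := by
  have hset : {u : ℝ | u ^ (1 / θ) * y ≤ x} ∩ Set.Icc 0 1 =
      Set.Icc 0 (x ^ θ * max x y ^ (-θ)) := by
    ext u
    simp only [Set.mem_inter_iff, Set.mem_ofPred_eq, Set.mem_Icc]
    have h1 : ∀ u : ℝ, 0 ≤ u → (u ^ (1 / θ) * y ≤ x ↔ u ≤ x ^ θ * y ^ (-θ)) := by
      intro u hu
      rw [Real.rpow_neg hy.le, ← div_eq_mul_inv, ← Real.div_rpow hx.le hy.le, ← le_div_iff₀ hy,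
        one_div, Real.rpow_inv_le_iff_of_pos hu (by positivity) hθ]
    have h2 : x ^ θ * max x y ^ (-θ) = min 1 (x ^ θ * y ^ (-θ)) := by
      have hxx : x ^ θ * x ^ (-θ) = 1 := by rw [← Real.rpow_add hx]; simp
      rcases le_total x y with h | h
      · rw [max_eq_right h, min_eq_right]
        rw [← hxx]
        exact mul_le_mul_of_nonneg_left
          (Real.rpow_le_rpow_of_nonpos hx h (by linarith)) (by positivity)
      · rw [max_eq_left h, min_eq_left]
        · exact hxx
        rw [← hxx]
        exact mul_le_mul_of_nonneg_left
          (Real.rpow_le_rpow_of_nonpos hy h (by linarith)) (by positivity)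
    rw [h2, le_min_iff]
    constructor
    · rintro ⟨ha, hb, hc⟩
      exact ⟨hb, hc, (h1 u hb).1 ha⟩
    · rintro ⟨hb, hc, ha⟩
      exact ⟨(h1 u hb).2 ha, hb, hc⟩
  have hm : MeasurableSet {u : ℝ | u ^ (1 / θ) * y ≤ x} :=
    measurableSet_le (by fun_prop) measurable_const
  rw [uniform01, Measure.restrict_apply hm, hset, Real.volume_Icc, sub_zero]

theorem measurable_max_rpow (x c a : ℝ) : Measurable fun w : ℝ => max x (w + c) ^ a :=
  (measurable_const.max (measurable_add_const c)).pow_const a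

theorem integrable_max_rpow {μ : Measure ℝ} [IsFiniteMeasure μ] {x : ℝ} (hx : 0 < x)
    {a : ℝ} (ha : 0 ≤ a) (c : ℝ) : Integrable (fun w => max x (w + c) ^ (-a)) μ := by
  refine Integrable.of_bound (measurable_max_rpow x c _).aestronglyMeasurable (x ^ (-a)) (Filter.Eventually.of_forall fun w => ?_)
  have h : x ≤ max x (w + c) := le_max_left _ _
  rw [Real.norm_of_nonneg (Real.rpow_nonneg (hx.le.trans h) _)]
  exact Real.rpow_le_rpow_of_nonpos hx h (by linarith)

/-- Conditioning on `w` instead: for `y = w + 1` the conditional probability is `min(1, (x/y)^θ)`,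
written with a maximum so that it matches the antiderivative of `cutPower`. -/
theorem dickmanTransform_real_Iic_eq_integral {θ : ℝ} (hθ : 0 < θ) {μ : Measure ℝ}
    [IsProbabilityMeasure μ] (hμ : ∀ᵐ w ∂μ, 0 ≤ w) {x : ℝ} (hx : 0 < x) :
    (dickmanTransform θ μ).real (Set.Iic x) = ∫ w, x ^ θ * max x (w + 1) ^ (-θ) ∂μ := by
  have hs : MeasurableSet ((fun p : ℝ × ℝ => p.1 ^ (1 / θ) * (p.2 + 1)) ⁻¹' Set.Iic x) :=
    measurable_dickmanMap θ measurableSet_Iic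
  have hnn : ∀ w, 0 ≤ x ^ θ * max x (w + 1) ^ (-θ) := fun w => by
    have : 0 < max x (w + 1) := lt_max_of_lt_left hx
    positivity
  rw [measureReal_def, dickmanTransform, Measure.map_apply (measurable_dickmanMap θ)
    measurableSet_Iic, Measure.prod_apply_symm hs,
    integral_eq_lintegral_of_nonneg_ae (Filter.Eventually.of_forall hnn)
      ((measurable_max_rpow x 1 _).const_mul _).aestronglyMeasurable]
  congr 1
  refine lintegral_congr_ae ?_
  filter_upwards [hμ] with w hw
  exact uniform01_rpow_mul_le hθ hx (by positivity : 0 < w + 1)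

theorem IsDickman.measureReal_Iic_le {θ : ℝ} (hθ : 0 < θ) {μ : Measure ℝ} (h : IsDickman θ μ)
    {x : ℝ} (hx : 0 < x) : μ.real (Set.Iic x) ≤ x ^ θ := by
  have := h.isProbabilityMeasure
  rw [← h.fixed, dickmanTransform_real_Iic_eq_integral hθ h.nonneg hx]
  calc ∫ w, x ^ θ * max x (w + 1) ^ (-θ) ∂μ ≤ ∫ w, x ^ θ ∂μ := by
        refine integral_mono_ae ((integrable_max_rpow hx hθ.le 1).const_mul _)
          (integrable_const _) ?_
        filter_upwards [h.nonneg] with w hw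
        refine mul_le_of_le_one_right (by positivity) ?_
        exact Real.rpow_le_one_of_one_le_of_nonpos (le_max_of_le_right (by linarith))
          (by linarith)
    _ = x ^ θ := by simp

theorem IsDickman.measureReal_Iic_zero {θ : ℝ} (hθ : 0 < θ) {μ : Measure ℝ}
    (h : IsDickman θ μ) : μ.real (Set.Iic 0) = 0 := by
  have := h.isProbabilityMeasure
  refine le_antisymm ?_ measureReal_nonneg
  have hlim : Filter.Tendsto (fun x : ℝ => x ^ θ) (nhdsWithin 0 (Set.Ioi 0)) (nhds 0) := by
    have := (Real.continuous_rpow_const hθ.le).tendsto 0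
    rw [Real.zero_rpow hθ.ne'] at this
    exact this.mono_left nhdsWithin_le_nhds
  refine ge_of_tendsto hlim ?_
  filter_upwards [self_mem_nhdsWithin] with x hx
  exact (measureReal_mono (Set.Iic_subset_Iic.2 (le_of_lt hx))).trans (h.measureReal_Iic_le hθ hx)

/-! ### The Stein identity. -/

/-- The function `y ↦ x ^ θ * y ^ (-θ-1)`, cut off to `0` for `y ≤ x`. -/
noncomputable def cutPower (θ x y : ℝ) : ℝ := if x < y then x ^ θ * y ^ (-θ - 1) else 0

theorem measurable_cutPower (θ x : ℝ) : Measurable (cutPower θ x) := by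
  unfold cutPower
  exact Measurable.ite measurableSet_Ioi (by fun_prop) measurable_const

theorem cutPower_nonneg {θ x : ℝ} (hx : 0 < x) (y : ℝ) : 0 ≤ cutPower θ x y := by
  unfold cutPower
  split_ifs with h
  · have : 0 < y := hx.trans h
    positivity
  · exact le_rfl

theorem rpow_mul_rpow_neg_sub_one {x : ℝ} (hx : 0 < x) (θ : ℝ) :
    x ^ θ * x ^ (-θ - 1) = x⁻¹ := by
  rw [← Real.rpow_add hx, ← Real.rpow_neg_one]
  congr 1
  ring

/-- `cutPower` jumps up at `x` and is therefore not monotone; here it becomes a difference of two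
antitone functions, to which monotone Riemann sum bounds apply. -/
theorem cutPower_eq {θ x : ℝ} (hx : 0 < x) (y : ℝ) :
    cutPower θ x y = x ^ θ * max x y ^ (-θ - 1) - x⁻¹ * (Set.Iic x).indicator 1 y := by
  unfold cutPower
  split_ifs with h
  · simp [max_eq_right h.le, h]
  · have h' := not_lt.1 h
    simp [h', rpow_mul_rpow_neg_sub_one hx]

theorem cutPower_le {θ x : ℝ} (hx : 0 < x) (y : ℝ) :
    cutPower θ x y ≤ x ^ θ * max x y ^ (-θ - 1) := by
  rw [cutPower_eq hx]
  have : 0 ≤ (Set.Iic x).indicator (1 : ℝ → ℝ) y := Set.indicator_nonneg (by simp) y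
  have := mul_nonneg (inv_pos.2 hx).le this
  linarith

theorem rpow_mul_max_rpow_le_inv {θ x : ℝ} (hθ : 0 < θ) (hx : 0 < x) (y : ℝ) :
    x ^ θ * max x y ^ (-θ - 1) ≤ x⁻¹ := by
  rw [← rpow_mul_rpow_neg_sub_one hx θ]
  exact mul_le_mul_of_nonneg_left
    (Real.rpow_le_rpow_of_nonpos hx (le_max_left _ _) (by linarith)) (by positivity)

theorem antitone_rpow_mul_max_rpow {x a : ℝ} (θ : ℝ) (hx : 0 < x) (ha : a ≤ 0) :
    Antitone fun y => x ^ θ * max x y ^ a := fun y z hyz =>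
  mul_le_mul_of_nonneg_left (Real.rpow_le_rpow_of_nonpos (lt_max_of_lt_left hx)
    (max_le_max_left _ hyz) ha) (by positivity)

theorem mul_cutPower {θ x w : ℝ} (hx : 0 < x) :
    w * cutPower θ x w = x ^ θ * max x w ^ (-θ) - (Set.Iic x).indicator 1 w := by
  unfold cutPower
  split_ifs with h
  · have hw : 0 < w := hx.trans h
    simp only [max_eq_right h.le, Set.indicator, Set.mem_Iic, not_le.2 h, if_false, sub_zero]
    rw [Real.rpow_sub hw, Real.rpow_one]
    field_simp
  · have h' := not_lt.1 h
    simp [h', ← Real.rpow_add hx]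

theorem intervalIntegrable_cutPower {θ x : ℝ} (hθ : 0 < θ) (hx : 0 < x) (w a b : ℝ) :
    IntervalIntegrable (fun u => cutPower θ x (w + u)) volume a b := by
  refine (intervalIntegrable_const (c := x⁻¹)).mono_fun
    ((measurable_cutPower θ x).comp (measurable_const_add w)).aestronglyMeasurable
    (Filter.Eventually.of_forall fun u => ?_)
  simp only [Real.norm_of_nonneg (cutPower_nonneg hx _), Real.norm_of_nonneg (inv_pos.2 hx).le]
  exact (cutPower_le hx _).trans (rpow_mul_max_rpow_le_inv hθ hx _)

/-- An antiderivative of the integrand times `θ` is `-x^θ max(x, w+u)^(-θ)`, differentiable except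
at the corner `u = x - w`; the fundamental theorem of calculus tolerates one exceptional point. -/
theorem integral_cutPower {θ x : ℝ} (hθ : 0 < θ) (hx : 0 < x) (w : ℝ) :
    θ * ∫ u in (0 : ℝ)..1, cutPower θ x (w + u) =
      x ^ θ * max x w ^ (-θ) - x ^ θ * max x (w + 1) ^ (-θ) := by
  have hpos : ∀ u, 0 < max x (w + u) := fun u => lt_max_of_lt_left hx
  have key := integral_eq_of_hasDerivAt_off_countable_of_le
    (fun u => -(x ^ θ * max x (w + u) ^ (-θ))) (fun u => θ * cutPower θ x (w + u))
    zero_le_one (s := {x - w}) (Set.countable_singleton _)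
    (Continuous.continuousOn (by
      refine (continuous_const.mul (Continuous.rpow_const (by fun_prop) fun u => ?_)).neg
      exact Or.inl (hpos u).ne')) ?_
    ((intervalIntegrable_cutPower hθ hx w 0 1).const_mul θ)
  · rw [intervalIntegral.integral_const_mul] at key
    rw [key]
    simp only [add_zero]
    ring
  · rintro u ⟨-, hu⟩
    rcases lt_or_gt_of_ne (show x ≠ w + u by
      rintro h; exact hu (by simp [h])) with h | h
    · have hwu : 0 < w + u := hx.trans h
      have hev : (fun u => -(x ^ θ * max x (w + u) ^ (-θ))) =ᶠ[nhds u]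
          fun u => -(x ^ θ * (w + u) ^ (-θ)) := by
        filter_upwards [(continuous_const_add w).continuousAt.eventually (lt_mem_nhds h)] with v hv
        rw [max_eq_right (le_of_lt hv)]
      refine HasDerivAt.congr_of_eventuallyEq ?_ hev
      have h1 : HasDerivAt (fun u => w + u) 1 u := (hasDerivAt_id u).const_add w
      convert! ((h1.rpow_const (p := -θ) (Or.inl hwu.ne')).const_mul (x ^ θ)).neg using 1
      rw [cutPower, if_pos h]
      ring
    · have hev : (fun u => -(x ^ θ * max x (w + u) ^ (-θ))) =ᶠ[nhds u]
          fun u => -(x ^ θ * x ^ (-θ)) := by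
        filter_upwards [(continuous_const_add w).continuousAt.eventually (gt_mem_nhds h)] with v hv
        rw [max_eq_left (le_of_lt hv)]
      refine HasDerivAt.congr_of_eventuallyEq ?_ hev
      rw [cutPower, if_neg (not_lt.2 h.le), mul_zero]
      exact hasDerivAt_const _ _

/-- The Stein identity: the distance of `μ` to its Dickman transform is the failure of the
size-bias identity for the test function `cutPower θ x`. -/
theorem dickmanTransform_real_Iic_sub {θ : ℝ} (hθ : 0 < θ) {μ : Measure ℝ}
    [IsProbabilityMeasure μ] (hμ : ∀ᵐ w ∂μ, 0 ≤ w) {x : ℝ} (hx : 0 < x) :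
    (dickmanTransform θ μ).real (Set.Iic x) - μ.real (Set.Iic x) =
      ∫ w, (w * cutPower θ x w - θ * ∫ u in (0 : ℝ)..1, cutPower θ x (w + u)) ∂μ := by
  rw [dickmanTransform_real_Iic_eq_integral hθ hμ hx, ← integral_indicator_one measurableSet_Iic,
    ← integral_sub (f := fun w => x ^ θ * max x (w + 1) ^ (-θ)) (g := (Set.Iic x).indicator (1 : ℝ → ℝ))
      ((integrable_max_rpow hx hθ.le 1).const_mul _)
      ((integrable_const (1 : ℝ)).indicator measurableSet_Iic)]
  refine integral_congr_ae (Filter.Eventually.of_forall fun w => ?_)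
  simp only
  rw [integral_cutPower hθ hx, mul_cutPower hx]
  ring

/-! ### Laplace transform and mean of the Dickman distribution. -/

theorem integral_uniform01 (f : ℝ → ℝ) : ∫ u, f u ∂uniform01 = ∫ u in (0 : ℝ)..1, f u := by
  rw [uniform01, integral_Icc_eq_integral_Ioc, intervalIntegral.integral_of_le zero_le_one]

theorem mul_exp_neg_mul_le {s z : ℝ} (hs : 0 < s) : z * Real.exp (-(s * z)) ≤ s⁻¹ := by
  have h := Real.add_one_le_exp (s * z)
  rw [Real.exp_neg, ← div_eq_mul_inv, div_le_iff₀ (Real.exp_pos _), inv_mul_eq_div, le_div_iff₀ hs]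
  linarith

/-- The integrand is the derivative of `u * exp (-(s * (u ^ (1/θ) * y)))`. -/
theorem integral_uniform01_exp {θ : ℝ} (hθ : 0 < θ) (s y : ℝ) :
    ∫ u, (Real.exp (-(s * (u ^ (1 / θ) * y))) -
      s / θ * (u ^ (1 / θ) * y * Real.exp (-(s * (u ^ (1 / θ) * y))))) ∂uniform01 =
      Real.exp (-(s * y)) := by
  have hc : Continuous fun u : ℝ => u ^ (1 / θ) := Real.continuous_rpow_const (by positivity)
  rw [integral_uniform01]
  have key := intervalIntegral.integral_eq_sub_of_hasDerivAt_of_le (a := 0) (b := 1)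
    (f := fun u => u * Real.exp (-(s * (u ^ (1 / θ) * y))))
    (f' := fun u => Real.exp (-(s * (u ^ (1 / θ) * y))) -
      s / θ * (u ^ (1 / θ) * y * Real.exp (-(s * (u ^ (1 / θ) * y))))) zero_le_one
    (by fun_prop) ?_ (Continuous.intervalIntegrable (by fun_prop) _ _)
  · rw [key]
    simp
  · rintro u ⟨hu, -⟩
    have h1 : HasDerivAt (fun u : ℝ => u ^ (1 / θ)) (1 / θ * u ^ (1 / θ - 1)) u :=
      Real.hasDerivAt_rpow_const (Or.inl hu.ne')
    have h2 : HasDerivAt (fun u : ℝ => -(s * (u ^ (1 / θ) * y)))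
        (-(s * (1 / θ * u ^ (1 / θ - 1) * y))) u := ((h1.mul_const y).const_mul s).neg
    convert! (hasDerivAt_id u).mul h2.exp using 1
    rw [Real.rpow_sub hu, Real.rpow_one]
    simp only [id]
    field_simp
    ring

/-- The size-bias identity of the Dickman distribution for exponential test functions. -/
theorem IsDickman.integral_mul_exp {θ : ℝ} (hθ : 0 < θ) {μ : Measure ℝ} (h : IsDickman θ μ)
    {s : ℝ} (hs : 0 < s) :
    Integrable (fun w => w * Real.exp (-(s * w))) μ ∧
    Integrable (fun w => Real.exp (-(s * w))) μ ∧
    s * ∫ w, w * Real.exp (-(s * w)) ∂μ =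
      θ * (1 - Real.exp (-s)) * ∫ w, Real.exp (-(s * w)) ∂μ := by
  have := h.isProbabilityMeasure
  have hI1 : Integrable (fun w => w * Real.exp (-(s * w))) μ := by
    refine Integrable.of_bound (by fun_prop) s⁻¹ ?_
    filter_upwards [h.nonneg] with w hw
    rw [Real.norm_of_nonneg (by positivity)]
    exact mul_exp_neg_mul_le hs
  have hI2 : Integrable (fun w => Real.exp (-(s * w))) μ := by
    refine Integrable.of_bound (by fun_prop) 1 ?_
    filter_upwards [h.nonneg] with w hw
    rw [Real.norm_of_nonneg (by positivity), Real.exp_le_one_iff]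
    nlinarith
  refine ⟨hI1, hI2, ?_⟩
  -- Averaging `ψ(U^(1/θ) (w+1))` over `U` returns the pure exponential `exp (-s (w+1))`; computing
  -- the mean of `ψ` directly and through the fixed point equation gives the identity.
  let ψ : ℝ → ℝ := fun z => Real.exp (-(s * z)) - s / θ * (z * Real.exp (-(s * z)))
  have hψ : Continuous ψ := by fun_prop
  have h1 : ∫ z, ψ z ∂μ = ∫ w, Real.exp (-(s * w)) ∂μ -
      s / θ * ∫ w, w * Real.exp (-(s * w)) ∂μ := by
    rw [integral_sub hI2 (hI1.const_mul _), integral_const_mul]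
  have h2 : ∫ z, ψ z ∂μ = Real.exp (-s) * ∫ w, Real.exp (-(s * w)) ∂μ := by
    conv_lhs => rw [← h.fixed]
    rw [dickmanTransform, integral_map (measurable_dickmanMap θ).aemeasurable
      hψ.aestronglyMeasurable, integral_prod_symm, ← integral_const_mul]
    · refine integral_congr_ae (Filter.Eventually.of_forall fun w => ?_)
      simp only [ψ]
      rw [integral_uniform01_exp hθ, ← Real.exp_add]
      congr 1
      ring
    · refine Integrable.of_bound
        (hψ.measurable.comp (measurable_dickmanMap θ)).aestronglyMeasurable
        (1 + s / θ * s⁻¹) ?_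
      have hu : ∀ᵐ p ∂(uniform01.prod μ), p.1 ∈ Set.Ioc (0 : ℝ) 1 :=
        Measure.quasiMeasurePreserving_fst.ae uniform01_ae_mem_Ioc
      have hw : ∀ᵐ p ∂(uniform01.prod μ), 0 ≤ p.2 :=
        Measure.quasiMeasurePreserving_snd.ae h.nonneg
      filter_upwards [hu, hw] with p hu hw
      have hz : 0 ≤ p.1 ^ (1 / θ) * (p.2 + 1) :=
        mul_nonneg (Real.rpow_nonneg hu.1.le _) (by linarith)
      refine (norm_sub_le _ _).trans (add_le_add ?_ ?_)
      · rw [Real.norm_of_nonneg (by positivity), Real.exp_le_one_iff]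
        nlinarith
      · rw [Real.norm_of_nonneg (by positivity)]
        exact mul_le_mul_of_nonneg_left (mul_exp_neg_mul_le hs) (by positivity)
  rw [h1] at h2
  field_simp at h2
  linarith

/-- By the Laplace identity and `1 - e^(-s) ≤ s`, the mean of `w e^(-sw)` is at most `θ` for every
`s > 0`; Fatou's lemma along `s = 1/(k+1)` then bounds the mean. -/
theorem IsDickman.integrable_id {θ : ℝ} (hθ : 0 < θ) {μ : Measure ℝ} (h : IsDickman θ μ) :
    Integrable (fun w => w) μ := by
  have := h.isProbabilityMeasure
  have hbound : ∀ s : ℝ, 0 < s → ∫⁻ w, ENNReal.ofReal (w * Real.exp (-(s * w))) ∂μ ≤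
      ENNReal.ofReal θ := by
    intro s hs
    obtain ⟨hI1, hI2, heq⟩ := h.integral_mul_exp hθ hs
    rw [← ofReal_integral_eq_lintegral_ofReal hI1]
    · refine ENNReal.ofReal_le_ofReal ?_
      have h1 : ∫ w, Real.exp (-(s * w)) ∂μ ≤ 1 := by
        calc ∫ w, Real.exp (-(s * w)) ∂μ ≤ ∫ w, (1 : ℝ) ∂μ := by
              refine integral_mono_ae hI2 (integrable_const _) ?_
              filter_upwards [h.nonneg] with w hw
              rw [Real.exp_le_one_iff]
              nlinarith
          _ = 1 := by simp
      have h2 : 1 - Real.exp (-s) ≤ s := by linarith [Real.add_one_le_exp (-s)]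
      have h3 : 0 ≤ 1 - Real.exp (-s) := by
        have := Real.exp_le_one_iff.2 (by linarith : -s ≤ 0)
        linarith
      refine le_of_mul_le_mul_left ?_ hs
      calc s * ∫ w, w * Real.exp (-(s * w)) ∂μ
          = θ * (1 - Real.exp (-s)) * ∫ w, Real.exp (-(s * w)) ∂μ := heq
        _ ≤ θ * (1 - Real.exp (-s)) * 1 := by gcongr
        _ ≤ θ * s * 1 := by gcongr
        _ = s * θ := by ring
    · filter_upwards [h.nonneg] with w hw
      positivity
  have hnn : 0 ≤ᵐ[μ] fun w : ℝ => w := h.nonneg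
  refine (lintegral_ofReal_ne_top_iff_integrable (by fun_prop) hnn).1 (ne_top_of_le_ne_top
    (ENNReal.ofReal_ne_top (r := θ)) ?_)
  have hF := lintegral_liminf_le (μ := μ) (u := Filter.atTop)
    (f := fun (k : ℕ) w => ENNReal.ofReal (w * Real.exp (-(((k : ℝ) + 1)⁻¹ * w))))
    (fun k => by fun_prop)
  have hlim : ∀ w : ℝ, Filter.liminf
      (fun k : ℕ => ENNReal.ofReal (w * Real.exp (-(((k : ℝ) + 1)⁻¹ * w)))) Filter.atTop =
      ENNReal.ofReal w := by
    intro w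
    refine Filter.Tendsto.liminf_eq (ENNReal.tendsto_ofReal ?_)
    have h0 : Filter.Tendsto (fun k : ℕ => ((k : ℝ) + 1)⁻¹) Filter.atTop (nhds 0) := by
      simpa using tendsto_one_div_add_atTop_nhds_zero_nat (𝕜 := ℝ)
    have hc : Continuous fun s : ℝ => w * Real.exp (-(s * w)) := by fun_prop
    have := (hc.tendsto 0).comp h0
    simp only [zero_mul, neg_zero, Real.exp_zero, mul_one] at this
    exact this
  simp only [hlim] at hF
  refine hF.trans ?_
  refine Filter.liminf_le_of_frequently_le' (Filter.Frequently.of_forall fun k => ?_)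
  exact hbound _ (by positivity)

/-! ### Contraction in a weighted norm and the resulting distance bound. -/

theorem integral_uniform01_rpow {θ : ℝ} (hθ : 0 < θ) :
    ∫ u, u ^ (1 / θ) ∂uniform01 = θ / (θ + 1) := by
  have : (-1 : ℝ) < 1 / θ := by
    have : 0 < 1 / θ := by positivity
    linarith
  rw [integral_uniform01, integral_rpow (Or.inl this), Real.one_rpow,
    Real.zero_rpow (by positivity)]
  field_simp
  ring

theorem integrable_uniform01_of_bounded {f : ℝ → ℝ} (hf : Measurable f) (hf0 : ∀ x, 0 ≤ f x)
    (hf1 : ∀ x, f x ≤ 1) : Integrable f uniform01 := by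
  refine Integrable.of_bound hf.aestronglyMeasurable 1 (Filter.Eventually.of_forall fun x => ?_)
  rw [Real.norm_of_nonneg (hf0 x)]
  exact hf1 x

/-- A weight function, decaying like `1/x`, in which the linear part of the Dickman transform is a
strict contraction. -/
theorem exists_contracting_weight {θ : ℝ} (hθ : 0 < θ) :
    ∃ (w : ℝ → ℝ) (ρ c : ℝ), Measurable w ∧ (∀ x, 0 ≤ w x) ∧ (∀ x, w x ≤ 1) ∧ 0 < c ∧
      (∀ x, 0 ≤ x → c ≤ w x * max 1 x) ∧ 0 ≤ ρ ∧ ρ < 1 ∧ (∀ x < 0, w x = 0) ∧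
      ∀ x, 0 < x → ∫ u, w (x / u ^ (1 / θ) - 1) ∂uniform01 ≤ ρ * w x := by
  -- In the plain sup norm the operator has norm one. Here `r` is the factor gained on `[θ+2, ∞)`
  -- from the decay of the weight, `κ` lies strictly between `r` and `1` and is the height to which
  -- the weight drops at `θ+2`, and `q` bounds below the part of `[0,1]` which, for `x < θ+2`, is
  -- mapped outside `[0, θ+2)`.
  obtain ⟨r, hr⟩ : ∃ r, r = θ * (θ + 2) / (θ + 1) ^ 2 := ⟨_, rfl⟩
  obtain ⟨κ, hκ⟩ : ∃ κ, κ = (1 + r) / 2 := ⟨_, rfl⟩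
  obtain ⟨q, hq⟩ : ∃ q, q = (θ + 3) ^ (-θ) := ⟨_, rfl⟩
  have hr0 : 0 < r := by rw [hr]; positivity
  have hr1 : r < 1 := by
    rw [hr, div_lt_one (by positivity)]
    nlinarith
  have hκ0 : 0 < κ := by linarith
  have hκ1 : κ < 1 := by linarith
  have hrκ : r < κ := by linarith
  have hq0 : 0 < q := by rw [hq]; positivity
  have hq1 : q ≤ 1 := by
    rw [hq]
    exact Real.rpow_le_one_of_one_le_of_nonpos (by linarith) (by linarith)
  let w : ℝ → ℝ := fun x => if x < 0 then 0 else if x < θ + 2 then 1 else κ * ((θ + 2) / x)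
  have hwm : Measurable w := Measurable.ite measurableSet_Iio measurable_const
    (Measurable.ite measurableSet_Iio measurable_const (by fun_prop))
  have hw0 : ∀ x, 0 ≤ w x := by
    intro x
    simp only [w]
    split_ifs with h1 h2
    · exact le_rfl
    · exact zero_le_one
    · have := not_lt.1 h1
      positivity
  have hfar : ∀ x, θ + 2 ≤ x → w x = κ * ((θ + 2) / x) := fun x hx => by
    simp only [w]
    rw [if_neg (by linarith), if_neg (not_lt.2 hx)]
  have hdiv : ∀ x, θ + 2 ≤ x → (θ + 2) / x ≤ 1 := fun x hx =>
    (div_le_one (by linarith)).2 hx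
  have hfarκ : ∀ x, θ + 2 ≤ x → w x ≤ κ := fun x hx => by
    rw [hfar x hx]
    exact mul_le_of_le_one_right hκ0.le (hdiv x hx)
  have hneg : ∀ x < 0, w x = 0 := fun x hx => if_pos hx
  have hw1 : ∀ x, w x ≤ 1 := by
    intro x
    rcases le_or_gt (θ + 2) x with h | h
    · exact (hfarκ x h).trans hκ1.le
    · simp only [w]
      split_ifs <;> simp
  have hnear : ∀ x, 0 ≤ x → x < θ + 2 → w x = 1 := fun x hx hx' => by
    simp only [w]
    rw [if_neg (not_lt.2 hx), if_pos hx']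
  -- The factor `κ` is given up here because the transformed point may fall below `θ+2`; this costs
  -- the division of `r` by `κ`.
  have hdec : ∀ x, 0 < x → w x ≤ (θ + 2) / x := by
    intro x hx
    rcases le_or_gt (θ + 2) x with h | h
    · rw [hfar x h]
      exact mul_le_of_le_one_left (by positivity) hκ1.le
    · rw [hnear x hx.le h, le_div_iff₀ hx]
      linarith
  have hm : ∀ x, Measurable fun u : ℝ => w (x / u ^ (1 / θ) - 1) := fun x =>
    hwm.comp ((measurable_const.div (measurable_id.pow_const _)).sub_const _)
  have hint : ∀ x, Integrable (fun u : ℝ => w (x / u ^ (1 / θ) - 1)) uniform01 := fun x =>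
    integrable_uniform01_of_bounded (hm x) (fun _ => hw0 _) fun _ => hw1 _
  have hv : ∀ u ∈ Set.Ioc (0 : ℝ) 1, 0 < u ^ (1 / θ) ∧ u ^ (1 / θ) ≤ 1 := fun u hu =>
    ⟨Real.rpow_pos_of_pos hu.1 _, Real.rpow_le_one hu.1.le hu.2 (by positivity)⟩
  refine ⟨w, max (r / κ) (κ + (1 - κ) * (1 - q)), κ, hwm, hw0, hw1, hκ0, ?_, ?_, ?_, hneg, ?_⟩
  · intro x hx
    rcases le_or_gt (θ + 2) x with h | h
    · have hx' : 0 < x := by linarith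
      rw [hfar x h, max_eq_right (by linarith), mul_assoc, div_mul_cancel₀ _ hx'.ne']
      nlinarith
    · rw [hnear x hx h, one_mul]
      exact hκ1.le.trans (le_max_left _ _)
  · exact le_max_of_le_left (by positivity)
  · refine max_lt ((div_lt_one hκ0).2 hrκ) ?_
    nlinarith
  · intro x hx
    rcases le_or_gt (θ + 2) x with h | h
    · have hb : ∀ᵐ u ∂uniform01, w (x / u ^ (1 / θ) - 1) ≤
          (θ + 2) / x * ((θ + 2) / (θ + 1)) * u ^ (1 / θ) := by
        filter_upwards [uniform01_ae_mem_Ioc] with u hu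
        obtain ⟨hv0, hv1⟩ := hv u hu
        generalize u ^ (1 / θ) = v at hv0 hv1
        have hxv : 0 < x - v := by linarith
        have hy : x / v - 1 = (x - v) / v := by field_simp
        rw [hy]
        refine (hdec _ (by positivity)).trans ?_
        -- From `v ≤ 1` and `x ≥ θ+2`, so that `x - v ≥ x (θ+1)/(θ+2)`.
        have h1 : (θ + 1) * x ≤ (θ + 2) * (x - v) := by nlinarith
        rw [div_div_eq_mul_div, div_mul_div_comm, div_mul_eq_mul_div,
          div_le_div_iff₀ hxv (by positivity)]
        nlinarith [mul_le_mul_of_nonneg_left h1 (by positivity : 0 ≤ (θ + 2) * v)]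
      have hint' : Integrable (fun u : ℝ => u ^ (1 / θ)) uniform01 :=
        (Real.continuous_rpow_const (by positivity)).continuousOn.integrableOn_compact
          isCompact_Icc
      calc ∫ u, w (x / u ^ (1 / θ) - 1) ∂uniform01
          ≤ ∫ u, (θ + 2) / x * ((θ + 2) / (θ + 1)) * u ^ (1 / θ) ∂uniform01 :=
            integral_mono_ae (hint x) (hint'.const_mul _) hb
        _ = r / κ * w x := by
            rw [integral_const_mul, integral_uniform01_rpow hθ, hfar x h, hr]
            field_simp
        _ ≤ _ := mul_le_mul_of_nonneg_right (le_max_left _ _) (hw0 x)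
    · rw [hnear x hx.le h, mul_one]
      refine le_trans ?_ (le_max_right _ _)
      obtain ⟨a, ha⟩ : ∃ a, a = x ^ θ * q := ⟨_, rfl⟩
      have ha' : a = (x / (θ + 3)) ^ θ := by
        rw [ha, hq, Real.div_rpow hx.le (by linarith), Real.rpow_neg (by linarith),
          div_eq_mul_inv]
      have ha0 : 0 < a := by rw [ha]; positivity
      -- The argument `x/u^(1/θ) - 1` is at least `θ+2` for `u ≤ a` and negative for `u > x^θ`; the
      -- weight can exceed `κ` only between the two.
      have hb : ∀ᵐ u ∂uniform01, w (x / u ^ (1 / θ) - 1) ≤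
          κ + (1 - κ) * (Set.Ioc a (x ^ θ)).indicator 1 u := by
        filter_upwards [uniform01_ae_mem_Ioc] with u hu
        obtain ⟨hv0, hv1⟩ := hv u hu
        by_cases hmem : u ∈ Set.Ioc a (x ^ θ)
        · rw [Set.indicator_of_mem hmem]
          simpa using hw1 _
        · rw [Set.indicator_of_notMem hmem, mul_zero, add_zero]
          by_cases hua : u ≤ a
          · refine hfarκ _ ?_
            rw [ha', ← Real.rpow_inv_le_iff_of_pos hu.1.le (by positivity) hθ, ← one_div,
              le_div_iff₀ (by positivity)] at hua
            rw [le_sub_iff_add_le, le_div_iff₀ hv0]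
            linarith
          · have hux : x ^ θ < u := by
              by_contra hcon
              exact hmem ⟨not_le.1 hua, not_lt.1 hcon⟩
            rw [hneg _ ?_]
            · exact hκ0.le
            · rw [sub_neg, div_lt_one hv0]
              rw [one_div]
              exact (Real.lt_rpow_inv_iff_of_pos hx.le hu.1.le hθ).2 hux
      have hIm : MeasurableSet (Set.Ioc a (x ^ θ)) := measurableSet_Ioc
      have hvol : uniform01.real (Set.Ioc a (x ^ θ)) ≤ 1 - q := by
        have hsub : Set.Ioc a (x ^ θ) ∩ Set.Icc 0 1 ⊆ Set.Icc a (min (x ^ θ) 1) :=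
          fun u hu => ⟨hu.1.1.le, le_min hu.1.2 hu.2.2⟩
        rw [uniform01, measureReal_restrict_apply hIm]
        refine (measureReal_mono hsub (by simp)).trans ?_
        rw [Real.volume_real_Icc]
        refine max_le ?_ (by linarith)
        rcases le_total (x ^ θ) 1 with h1 | h1
        · rw [min_eq_left h1, ha]
          nlinarith
        · rw [min_eq_right h1, ha]
          nlinarith
      calc ∫ u, w (x / u ^ (1 / θ) - 1) ∂uniform01
          ≤ ∫ u, (κ + (1 - κ) * (Set.Ioc a (x ^ θ)).indicator 1 u) ∂uniform01 :=
            integral_mono_ae (hint x) ((integrable_const _).add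
              (((integrable_const (1 : ℝ)).indicator hIm).const_mul _)) hb
        _ = κ + (1 - κ) * uniform01.real (Set.Ioc a (x ^ θ)) := by
            rw [integral_add (f := fun _ => κ)
              (g := fun u => (1 - κ) * (Set.Ioc a (x ^ θ)).indicator (1 : ℝ → ℝ) u)
              (integrable_const _) (((integrable_const (1 : ℝ)).indicator hIm).const_mul _),
              integral_const_mul, integral_indicator_one hIm]
            simp
        _ ≤ κ + (1 - κ) * (1 - q) := by
            have : 0 ≤ 1 - κ := by linarith
            gcongr

/-- Markov's inequality for both upper tails. It supplies the finite a priori weighted norm from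
which the contraction can be iterated. -/
theorem abs_measureReal_Iic_sub_le {μ ν : Measure ℝ} [IsProbabilityMeasure μ]
    [IsProbabilityMeasure ν] (hμ : ∀ᵐ w ∂μ, 0 ≤ w) (hν : ∀ᵐ w ∂ν, 0 ≤ w)
    (hμ1 : Integrable (fun w => w) μ) (hν1 : Integrable (fun w => w) ν) {x : ℝ} (hx : 0 ≤ x) :
    |μ.real (Set.Iic x) - ν.real (Set.Iic x)| * max 1 x ≤
      1 + (∫ w, w ∂μ) + ∫ w, w ∂ν := by
  have hmk : ∀ (τ : Measure ℝ) [IsProbabilityMeasure τ], (∀ᵐ w ∂τ, 0 ≤ w) →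
      Integrable (fun w => w) τ → 0 ≤ ∫ w, w ∂τ ∧ τ.real (Set.Iic x) ≤ 1 ∧
        0 ≤ τ.real (Set.Iic x) ∧ (1 - τ.real (Set.Iic x)) * x ≤ ∫ w, w ∂τ := by
    intro τ _ hτ hτ1
    refine ⟨integral_nonneg_of_ae hτ, measureReal_le_one, measureReal_nonneg, ?_⟩
    rw [← probReal_compl_eq_one_sub measurableSet_Iic, mul_comm, Set.compl_Iic]
    refine le_trans ?_ (mul_meas_ge_le_integral_of_nonneg hτ hτ1 x)
    exact mul_le_mul_of_nonneg_left (measureReal_mono fun w (hw : x < w) => hw.le) hx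
  obtain ⟨h1, h2, h3, h4⟩ := hmk μ hμ hμ1
  obtain ⟨g1, g2, g3, g4⟩ := hmk ν hν hν1
  rcases le_total x 1 with h | h
  · rw [max_eq_left h, mul_one, abs_le]
    constructor <;> linarith
  · rw [max_eq_right h]
    have : |μ.real (Set.Iic x) - ν.real (Set.Iic x)| * x =
        |(μ.real (Set.Iic x) - ν.real (Set.Iic x)) * x| := by rw [abs_mul, abs_of_nonneg hx]
    rw [this, abs_le]
    constructor <;> nlinarith

theorem measureReal_Iic_eq_zero_of_neg {μ : Measure ℝ} (hμ : ∀ᵐ w ∂μ, 0 ≤ w) {x : ℝ}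
    (hx : x < 0) : μ.real (Set.Iic x) = 0 := by
  have h : μ (Set.Iic x) = 0 :=
    measure_mono_null (fun w (hw : w ≤ x) => not_le.2 (lt_of_le_of_lt hw hx)) hμ
  rw [measureReal_def, h, ENNReal.toReal_zero]

/-- A bound of the Kolmogorov distance to the Dickman distribution in terms of the distance
between a distribution and its Dickman transform. -/
theorem exists_kolmogorov_bound {θ : ℝ} (hθ : 0 < θ) :
    ∃ K : ℝ, 0 < K ∧ ∀ (μ : Measure ℝ) [IsProbabilityMeasure μ], (∀ᵐ w ∂μ, 0 ≤ w) →
      Integrable (fun w => w) μ → ∀ ε : ℝ, 0 ≤ ε →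
      (∀ x, 0 ≤ x → |(dickman θ).real (Set.Iic x) - μ.real (Set.Iic x)| * max 1 x ≤ ε ∨
        0 < x ∧
        |(dickmanTransform θ μ).real (Set.Iic x) - μ.real (Set.Iic x)| * max 1 x ≤ ε) →
      kolmogorovDist μ (dickman θ) ≤ K * ε := by
  obtain ⟨w, ρ, c, hwm, hw0, hw1, hc, hcw, hρ0, hρ1, hneg, hT⟩ := exists_contracting_weight hθ
  have hD := isDickman_dickman hθ
  have hDp := hD.isProbabilityMeasure
  have h1ρ : 0 < 1 - ρ := by linarith
  refine ⟨1 / c / (1 - ρ), by positivity, fun μ _ hμ hμ1 ε hε hx => ?_⟩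
  let H : ℝ → ℝ := fun x => (dickman θ).real (Set.Iic x) - μ.real (Set.Iic x)
  have hHneg : ∀ x < 0, H x = 0 := fun x hx => by
    simp only [H]
    rw [measureReal_Iic_eq_zero_of_neg hD.nonneg hx, measureReal_Iic_eq_zero_of_neg hμ hx, sub_zero]
  have hle : ∀ x, 0 ≤ x → ∀ a b, a * max 1 x ≤ b → 0 ≤ b → a ≤ b / c * w x := by
    intro x hx a b hab hb
    have hm : 0 < max 1 x := lt_max_of_lt_left one_pos
    refine le_of_mul_le_mul_right (hab.trans ?_) hm
    calc b = b / c * c := by field_simp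
      _ ≤ b / c * (w x * max 1 x) := by
          gcongr
          exact hcw x hx
      _ = b / c * w x * max 1 x := by ring
  obtain ⟨K₀, hK₀0, hK₀⟩ : ∃ K₀, 0 ≤ K₀ ∧ ∀ x, |H x| ≤ K₀ * w x := by
    have hb : 0 ≤ 1 + (∫ y, y ∂(dickman θ)) + ∫ y, y ∂μ := by
      have h1 : 0 ≤ ∫ y, y ∂(dickman θ) := integral_nonneg_of_ae hD.nonneg
      have h2 : 0 ≤ ∫ y, y ∂μ := integral_nonneg_of_ae hμ
      linarith
    refine ⟨(1 + (∫ y, y ∂(dickman θ)) + ∫ y, y ∂μ) / c, by positivity, fun x => ?_⟩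
    rcases lt_or_ge x 0 with hx | hx
    · rw [hHneg x hx, hneg x hx]
      simp
    · exact hle x hx _ _ (abs_measureReal_Iic_sub_le hD.nonneg hμ (hD.integrable_id hθ) hμ1 hx) hb
  -- `H` equals its image under the linear operator plus the defect `Tμ - μ`. Where `H` itself is
  -- known to be small, the equation is not used.
  have hstep : ∀ K, 0 ≤ K → (∀ x, |H x| ≤ K * w x) → ∀ x, |H x| ≤ (ρ * K + ε / c) * w x := by
    intro K hK hKw x
    rcases lt_or_ge x 0 with hx0 | hx0
    · rw [hHneg x hx0, hneg x hx0]
      simp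
    have hadd : (ρ * K + ε / c) * w x = ρ * K * w x + ε / c * w x := by ring
    rw [hadd]
    rcases hx x hx0 with h | ⟨hx', h⟩
    · refine (hle x hx0 _ _ h hε).trans ?_
      have := hw0 x
      have : 0 ≤ ρ * K * w x := by positivity
      linarith
    · have h2 := hle x hx0 _ _ h hε
      obtain ⟨hiD, heD⟩ := dickmanTransform_real_Iic θ (dickman θ) x
      obtain ⟨hiμ, heμ⟩ := dickmanTransform_real_Iic θ μ x
      rw [hD.fixed] at heD
      have hsplit : H x = (∫ u, H (x / u ^ (1 / θ) - 1) ∂uniform01) +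
          ((dickmanTransform θ μ).real (Set.Iic x) - μ.real (Set.Iic x)) := by
        simp only [H]
        rw [integral_sub hiD hiμ, ← heD, ← heμ]
        ring
      rw [hsplit]
      refine (abs_add_le _ _).trans (add_le_add ?_ h2)
      have hwi : Integrable (fun u : ℝ => w (x / u ^ (1 / θ) - 1)) uniform01 :=
        integrable_uniform01_of_bounded
          (hwm.comp ((measurable_const.div (measurable_id.pow_const _)).sub_const _))
          (fun _ => hw0 _) fun _ => hw1 _
      calc |∫ u, H (x / u ^ (1 / θ) - 1) ∂uniform01|
          ≤ ∫ u, |H (x / u ^ (1 / θ) - 1)| ∂uniform01 := abs_integral_le_integral_abs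
        _ ≤ ∫ u, K * w (x / u ^ (1 / θ) - 1) ∂uniform01 :=
            integral_mono (hiD.sub hiμ).abs (hwi.const_mul K) fun u => hKw _
        _ = K * ∫ u, w (x / u ^ (1 / θ) - 1) ∂uniform01 := integral_const_mul _ _
        _ ≤ K * (ρ * w x) := by
            gcongr
            exact hT x hx'
        _ = ρ * K * w x := by ring
  -- `ε/c/(1-ρ)` is the fixed point of `K ↦ ρ K + ε/c`, so only the a priori part decays.
  have hiter : ∀ m : ℕ, ∀ x, |H x| ≤ (ρ ^ m * K₀ + ε / c / (1 - ρ)) * w x := by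
    intro m
    induction m with
    | zero =>
      intro x
      refine (hK₀ x).trans (mul_le_mul_of_nonneg_right ?_ (hw0 x))
      have : 0 ≤ ε / c / (1 - ρ) := by positivity
      simp [this]
    | succ m ih =>
      intro x
      refine (hstep _ (by positivity) ih x).trans (le_of_eq ?_)
      congr 1
      field_simp
      ring
  have hfinal : ∀ x, |H x| ≤ 1 / c / (1 - ρ) * ε := by
    intro x
    have hlim : Filter.Tendsto (fun m : ℕ => ρ ^ m * K₀ + ε / c / (1 - ρ)) Filter.atTop
        (nhds (0 * K₀ + ε / c / (1 - ρ))) :=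
      ((tendsto_pow_atTop_nhds_zero_of_lt_one hρ0 hρ1).mul_const _).add_const _
    have heq : 1 / c / (1 - ρ) * ε = 0 * K₀ + ε / c / (1 - ρ) := by ring
    rw [heq]
    exact ge_of_tendsto hlim (Filter.Eventually.of_forall fun m => (hiter m x).trans
      (mul_le_of_le_one_right (by positivity) (hw1 x)))
  have : Nonempty (Set.Ici (0 : ℝ)) := ⟨⟨0, Set.mem_Ici.2 le_rfl⟩⟩
  refine ciSup_le fun a => ?_
  rw [abs_sub_comm]
  exact hfinal a

/-! ### Riemann sums, harmonic sums and truncated negative moments. -/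

/-- The right-endpoint sum lies below the integral, the left-endpoint sum above it, and they differ
by `(g 0 - g 1)/n`. -/
theorem Antitone.riemann_sum_bounds {g : ℝ → ℝ} (hg : Antitone g) {n : ℕ} (hn : 1 ≤ n) :
    (n : ℝ)⁻¹ * ∑ k ∈ Finset.Icc 1 n, g (k / n) ≤ ∫ u in (0 : ℝ)..1, g u ∧
    ∫ u in (0 : ℝ)..1, g u ≤ (n : ℝ)⁻¹ * (∑ k ∈ Finset.Icc 1 n, g (k / n) + g 0 - g 1) := by
  have hn0 : (0 : ℝ) < n := by exact_mod_cast hn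
  have hf : AntitoneOn (fun x : ℝ => g (x / n)) (Set.Icc 0 (0 + n)) := fun x _ y _ hxy =>
    hg (div_le_div_of_nonneg_right hxy hn0.le)
  have hint : ∫ x in (0 : ℝ)..0 + n, g (x / n) = n * ∫ u in (0 : ℝ)..1, g u := by
    rw [intervalIntegral.integral_comp_div _ hn0.ne', zero_add, zero_div, div_self hn0.ne',
      smul_eq_mul]
  have hsum : ∑ k ∈ Finset.Icc 1 n, g (k / n) =
      ∑ i ∈ Finset.range n, g (((i + 1 : ℕ) : ℝ) / n) := by
    rw [Finset.range_eq_Ico, Finset.sum_Ico_add' (fun i : ℕ => g ((i : ℝ) / n)) 0 n 1]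
    rfl
  have h1 := hf.sum_le_integral
  have h2 := hf.integral_le_sum
  have h3 := Finset.sum_range_succ' (fun i : ℕ => g ((i : ℝ) / n)) n
  rw [Finset.sum_range_succ, div_self hn0.ne'] at h3
  rw [hint] at h1 h2
  simp only [zero_add] at h1 h2
  simp only [Nat.cast_zero, zero_div] at h3
  rw [hsum, inv_mul_le_iff₀ hn0, le_inv_mul_iff₀ hn0]
  exact ⟨h1, by linarith⟩

theorem log_le_sum_Icc_inv {m n : ℕ} (hm : 1 ≤ m) (hmn : m ≤ n + 1) :
    Real.log ((n + 1) / m) ≤ ∑ k ∈ Finset.Icc m n, (k : ℝ)⁻¹ := by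
  have hm0 : (0 : ℝ) < m := by exact_mod_cast hm
  rcases Nat.eq_or_lt_of_le hmn with h | h
  · have : ((n : ℝ) + 1) / m = 1 := by
      rw [h]
      push_cast
      exact div_self (by positivity)
    rw [this, Real.log_one]
    positivity
  · have hmn' : m ≤ n := by lia
    clear h hmn
    induction n, hmn' using Nat.le_induction with
    | base =>
      have h := Real.log_le_sub_one_of_pos (x := ((m : ℝ) + 1) / m) (by positivity)
      have h2 : ((m : ℝ) + 1) / m - 1 = (m : ℝ)⁻¹ := by
        field_simp
        ring
      simpa [h2] using h
    | succ n hmn ih =>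
      rw [Finset.sum_Icc_succ_top (by lia)]
      have h := Real.log_le_sub_one_of_pos (x := ((n + 1 : ℕ) + 1 : ℝ) / (n + 1)) (by positivity)
      have h2 : Real.log (((n + 1 : ℕ) + 1 : ℝ) / m) =
          Real.log ((n + 1) / m) + Real.log (((n + 1 : ℕ) + 1 : ℝ) / (n + 1)) := by
        rw [← Real.log_mul (by positivity) (by positivity)]
        congr 1
        field_simp
      have h3 : ((n + 1 : ℕ) + 1 : ℝ) / (n + 1) - 1 = ((n + 1 : ℕ) : ℝ)⁻¹ := by
        push_cast
        field_simp
        ring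
      linarith

theorem sum_Icc_inv_le_log {m n : ℕ} (hm : 1 ≤ m) (hmn : m ≤ n) :
    ∑ k ∈ Finset.Icc m n, (k : ℝ)⁻¹ ≤ 1 + Real.log (n / m) := by
  have hm0 : (0 : ℝ) < m := by exact_mod_cast hm
  induction n, hmn using Nat.le_induction with
  | base =>
    simp only [Finset.Icc_self, Finset.sum_singleton, div_self hm0.ne', Real.log_one, add_zero]
    exact inv_le_one_of_one_le₀ (by exact_mod_cast hm)
  | succ n hmn ih =>
    have hn0 : (0 : ℝ) < n := hm0.trans_le (by exact_mod_cast hmn)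
    rw [Finset.sum_Icc_succ_top (by lia)]
    have h := Real.one_sub_inv_le_log_of_pos (x := ((n + 1 : ℕ) : ℝ) / n) (by positivity)
    have h2 : Real.log (((n + 1 : ℕ) : ℝ) / m) =
        Real.log (n / m) + Real.log (((n + 1 : ℕ) : ℝ) / n) := by
      rw [← Real.log_mul (by positivity) (by positivity)]
      congr 1
      field_simp
    have h3 : 1 - (((n + 1 : ℕ) : ℝ) / n)⁻¹ = ((n + 1 : ℕ) : ℝ)⁻¹ := by
      push_cast
      field_simp
      ring
    linarith

/-- Makes the constants independent of `l`: for `β < 0` the ratio `(k+β)/k` increases in `k`, so its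
value at the smallest integer `m > -β` serves every admissible `l`. -/
theorem exists_mul_le_add (β : ℝ) : ∃ b : ℝ, 0 < b ∧ ∀ l k : ℕ, 1 ≤ l → -β < (l : ℝ) → l ≤ k →
    b * k ≤ k + β := by
  rcases le_or_gt 0 β with h | h
  · exact ⟨1, one_pos, fun l k _ _ _ => by linarith⟩
  · have hm : -β < ((⌊-β⌋₊ + 1 : ℕ) : ℝ) := by
      push_cast
      exact Nat.lt_floor_add_one _
    obtain ⟨m, hm'⟩ : ∃ m, m = ⌊-β⌋₊ + 1 := ⟨_, rfl⟩
    rw [← hm'] at hm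
    have hm0 : (0 : ℝ) < m := by linarith
    refine ⟨(m + β) / m, div_pos (by linarith) hm0, fun l k hl hlβ hlk => ?_⟩
    have hml : m ≤ l := by
      rw [hm']
      exact (Nat.floor_lt (by linarith)).2 hlβ
    have hmk : (m : ℝ) ≤ k := by exact_mod_cast hml.trans hlk
    rw [div_mul_eq_mul_div, div_le_iff₀ hm0]
    nlinarith

/-- Termwise the difference is at most `|β|/(b k²)`, hence summable: the shift by `β` changes
harmonic sums only by a bounded amount. -/
theorem abs_sum_inv_add_sub_le {β b : ℝ} (hb : 0 < b) {l : ℕ} (hl : 1 ≤ l)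
    (h : ∀ k : ℕ, l ≤ k → b * k ≤ k + β) {m n : ℕ} (hlm : l ≤ m) :
    |∑ k ∈ Finset.Icc m n, ((k : ℝ) + β)⁻¹ - ∑ k ∈ Finset.Icc m n, (k : ℝ)⁻¹| ≤
      |β| / b * ∑' k : ℕ, ((k : ℝ) ^ 2)⁻¹ := by
  rw [← Finset.sum_sub_distrib]
  have hs : Summable fun k : ℕ => ((k : ℝ) ^ 2)⁻¹ := Real.summable_nat_pow_inv.2 one_lt_two
  calc |∑ k ∈ Finset.Icc m n, (((k : ℝ) + β)⁻¹ - (k : ℝ)⁻¹)|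
      ≤ ∑ k ∈ Finset.Icc m n, |((k : ℝ) + β)⁻¹ - (k : ℝ)⁻¹| := Finset.abs_sum_le_sum_abs _ _
    _ ≤ ∑ k ∈ Finset.Icc m n, |β| / b * ((k : ℝ) ^ 2)⁻¹ := by
        refine Finset.sum_le_sum fun k hk => ?_
        have hlk : l ≤ k := hlm.trans (Finset.mem_Icc.1 hk).1
        have hk0 : (0 : ℝ) < k := by exact_mod_cast hl.trans hlk
        have hkb := h k hlk
        have hkβ : 0 < (k : ℝ) + β := lt_of_lt_of_le (by positivity) hkb
        have : ((k : ℝ) + β)⁻¹ - (k : ℝ)⁻¹ = -β / ((k + β) * k) := by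
          field_simp
          ring
        rw [this, abs_div, abs_neg, abs_of_pos (mul_pos hkβ hk0), ← div_eq_mul_inv, div_div]
        refine div_le_div_of_nonneg_left (abs_nonneg _) (by positivity) ?_
        nlinarith
    _ = |β| / b * ∑ k ∈ Finset.Icc m n, ((k : ℝ) ^ 2)⁻¹ := (Finset.mul_sum _ _ _).symm
    _ ≤ _ := by
        gcongr
        exact hs.sum_le_tsum _ fun k _ => by positivity

/-- Write `max(x,w)^(-a)` as the integral of `a y^(-a-1)` over `y > max(x,w)` and exchange
integrals. Only values of the distribution function beyond `x` enter, which matters because the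
power bound for the Poisson sum fails near `0`. -/
theorem integral_max_rpow_le {μ : Measure ℝ} [IsProbabilityMeasure μ] {θ a C x : ℝ}
    (ha0 : 0 < a) (ha : θ < a) (hx : 0 < x) (hC : 0 ≤ C)
    (hG : ∀ y, x ≤ y → μ.real (Set.Iic y) ≤ C * y ^ θ) :
    ∫ w, max x w ^ (-a) ∂μ ≤ C * (a / (a - θ)) * x ^ (θ - a) := by
  have hmax : ∀ w, 0 < max x w := fun w => lt_max_of_lt_left hx
  have hpow : ∀ (p c : ℝ), p < -1 → 0 < c → IntegrableOn (fun y : ℝ => y ^ p) (Set.Ioi c) :=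
    fun p c hp hc => integrableOn_Ioi_rpow_of_lt hp hc
  have hrep : ∀ w, ENNReal.ofReal (max x w ^ (-a)) =
      ∫⁻ y in Set.Ioi x, (Set.Ioi w).indicator (fun y => ENNReal.ofReal (a * y ^ (-a - 1))) y := by
    intro w
    rw [setLIntegral_indicator measurableSet_Ioi, Set.Ioi_inter_Ioi, sup_comm w x,
      ← ofReal_integral_eq_lintegral_ofReal
        ((hpow (-a - 1) _ (by linarith) (hmax w)).const_mul a),
      integral_const_mul, integral_Ioi_rpow_of_lt (by linarith) (hmax w)]
    · congr 1
      have : -a - 1 + 1 = -a := by ring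
      rw [this]
      field_simp
    · filter_upwards [ae_restrict_mem measurableSet_Ioi] with y hy
      have : 0 < y := (hmax w).trans hy
      positivity
  rw [integral_eq_lintegral_of_nonneg_ae
    (Filter.Eventually.of_forall fun w => Real.rpow_nonneg (hmax w).le _)
    ((measurable_const.max measurable_id).pow_const _).aestronglyMeasurable]
  refine ENNReal.toReal_le_of_le_ofReal (by have := sub_pos.2 ha; positivity) ?_
  simp only [hrep]
  have hmeas : Measurable fun p : ℝ × ℝ =>
      (Set.Ioi p.1).indicator (fun y => ENNReal.ofReal (a * y ^ (-a - 1))) p.2 := by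
    have : (fun p : ℝ × ℝ => (Set.Ioi p.1).indicator
        (fun y => ENNReal.ofReal (a * y ^ (-a - 1))) p.2) =
        {p : ℝ × ℝ | p.1 < p.2}.indicator (fun p => ENNReal.ofReal (a * p.2 ^ (-a - 1))) := by
      ext p
      simp [Set.indicator]
    rw [this]
    exact Measurable.indicator (by fun_prop) (measurableSet_lt measurable_fst measurable_snd)
  rw [lintegral_lintegral_swap hmeas.aemeasurable]
  have hin : ∀ y, ∫⁻ w, (Set.Ioi w).indicator (fun y => ENNReal.ofReal (a * y ^ (-a - 1))) y ∂μ =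
      ENNReal.ofReal (a * y ^ (-a - 1)) * μ (Set.Iio y) := by
    intro y
    have : (fun w => (Set.Ioi w).indicator (fun y => ENNReal.ofReal (a * y ^ (-a - 1))) y) =
        (Set.Iio y).indicator (fun _ => ENNReal.ofReal (a * y ^ (-a - 1))) := by
      ext w
      simp [Set.indicator]
    rw [this, lintegral_indicator_const measurableSet_Iio]
  simp only [hin]
  calc ∫⁻ y in Set.Ioi x, ENNReal.ofReal (a * y ^ (-a - 1)) * μ (Set.Iio y)
      ≤ ∫⁻ y in Set.Ioi x, ENNReal.ofReal (C * a * y ^ (θ - a - 1)) := by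
        refine setLIntegral_mono' measurableSet_Ioi fun y hy => ?_
        have hxy : x < y := hy
        have hy0 : 0 < y := hx.trans hxy
        have h1 : μ (Set.Iio y) ≤ ENNReal.ofReal (C * y ^ θ) :=
          (measure_mono Set.Iio_subset_Iic_self).trans
            ((ENNReal.le_ofReal_iff_toReal_le (measure_ne_top _ _) (by positivity)).2
              (hG y hxy.le))
        refine (mul_le_mul_right h1 _).trans (le_of_eq ?_)
        rw [← ENNReal.ofReal_mul (by positivity)]
        congr 1
        have : θ - a - 1 = θ + (-a - 1) := by ring
        rw [this, Real.rpow_add hy0]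
        ring
    _ = ENNReal.ofReal (C * (a / (a - θ)) * x ^ (θ - a)) := by
        rw [← ofReal_integral_eq_lintegral_ofReal ((hpow (θ - a - 1) _ (by linarith) hx).const_mul _),
          integral_const_mul, integral_Ioi_rpow_of_lt (by linarith) hx]
        · congr 1
          have h1 : θ - a - 1 + 1 = θ - a := by ring
          have h2 : a - θ ≠ 0 := (sub_pos.2 ha).ne'
          have h3 : θ - a ≠ 0 := (sub_neg.2 ha).ne
          rw [h1]
          field_simp
          ring
        · filter_upwards [ae_restrict_mem measurableSet_Ioi] with y hy
          have : 0 < y := hx.trans hy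
          positivity

/-! ### Discretisation error for `cutPower`. -/

/-- With `cutPower = g - h`, both antitone and nonnegative, the Riemann errors have the same sign,
so their difference lies between `-h 0/n` and `g 0/n`; and `h 0 ≤ g 0`. -/
theorem abs_riemann_sum_cutPower_sub_le {θ x : ℝ} (hθ : 0 < θ) (hx : 0 < x) {n : ℕ} (hn : 1 ≤ n)
    (w : ℝ) :
    |(n : ℝ)⁻¹ * ∑ k ∈ Finset.Icc 1 n, cutPower θ x (w + k / n) -
      ∫ u in (0 : ℝ)..1, cutPower θ x (w + u)| ≤
      (n : ℝ)⁻¹ * (x ^ θ * max x w ^ (-θ - 1)) := by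
  have hn0 : (0 : ℝ) < n := by exact_mod_cast hn
  let g : ℝ → ℝ := fun u => x ^ θ * max x (w + u) ^ (-θ - 1)
  let h : ℝ → ℝ := fun u => x⁻¹ * (Set.Iic x).indicator 1 (w + u)
  have hgm : Antitone g := (antitone_rpow_mul_max_rpow θ hx (by linarith)).comp_monotone
    (monotone_id.const_add w)
  have hhm : Antitone h := by
    intro u v huv
    refine mul_le_mul_of_nonneg_left ?_ (inv_pos.2 hx).le
    by_cases hv : w + v ≤ x
    · have hu : w + u ≤ x := by linarith
      simp [Set.indicator, hu, hv]
    · simp only [Set.indicator, Set.mem_Iic, hv, if_false]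
      split_ifs <;> simp
  have hf : ∀ u, cutPower θ x (w + u) = g u - h u := fun u => cutPower_eq hx _
  have hg0 : ∀ u, 0 ≤ g u := fun u => by
    have : 0 < max x (w + u) := lt_max_of_lt_left hx
    positivity
  have hh0 : ∀ u, 0 ≤ h u := fun u =>
    mul_nonneg (inv_pos.2 hx).le (Set.indicator_nonneg (by simp) _)
  have hgh : h 0 ≤ g 0 := by
    have := cutPower_nonneg (θ := θ) hx (w + 0)
    rw [hf] at this
    linarith
  have hval : x ^ θ * max x w ^ (-θ - 1) = g 0 := by simp [g]
  obtain ⟨g1, g2⟩ := hgm.riemann_sum_bounds hn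
  obtain ⟨h1, h2⟩ := hhm.riemann_sum_bounds hn
  simp only [hf]
  rw [hval, Finset.sum_sub_distrib, intervalIntegral.integral_sub
    hgm.intervalIntegrable hhm.intervalIntegrable]
  have hi : 0 < (n : ℝ)⁻¹ := by positivity
  have a1 := mul_nonneg hi.le (hg0 1)
  have a2 := mul_nonneg hi.le (hh0 1)
  have a3 := mul_le_mul_of_nonneg_left hgh hi.le
  rw [mul_sub, abs_le]
  simp only [mul_add, mul_sub] at g2 h2
  constructor <;> linarith

/-- The factor `l` counts the `l - 1` absent terms `k < l` and one unit for the Riemann error. The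
last sum comes from `k/(k+β) = 1 - β/(k+β)` and `k + β ≥ b k`. -/
theorem abs_weighted_sum_cutPower_sub_le {θ β b x : ℝ} (hθ : 0 < θ) (hx : 0 < x) (hb : 0 < b)
    {l n : ℕ} (hl : 1 ≤ l) (hln : l ≤ n) (h : ∀ k : ℕ, l ≤ k → b * k ≤ k + β) (w : ℝ) :
    |∑ k ∈ Finset.Icc l n, (k / n : ℝ) * ((k : ℝ) + β)⁻¹ * cutPower θ x (w + k / n) -
      ∫ u in (0 : ℝ)..1, cutPower θ x (w + u)| ≤
      l / n * (x ^ θ * max x w ^ (-θ - 1)) +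
        |β| / b / n * ∑ k ∈ Finset.Icc l n, (k : ℝ)⁻¹ * cutPower θ x (w + k / n) := by
  have hn0 : (0 : ℝ) < n := by exact_mod_cast hl.trans hln
  have hi : 0 < (n : ℝ)⁻¹ := by positivity
  obtain ⟨M, hM⟩ : ∃ M, M = x ^ θ * max x w ^ (-θ - 1) := ⟨_, rfl⟩
  have hR := abs_riemann_sum_cutPower_sub_le hθ hx (hl.trans hln) w
  rw [← hM] at hR ⊢
  have hfM : ∀ k : ℕ, cutPower θ x (w + k / n) ≤ M := fun k => by
    rw [hM]
    refine (cutPower_le hx _).trans (antitone_rpow_mul_max_rpow θ hx (by linarith) ?_)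
    have : (0 : ℝ) ≤ k / n := by positivity
    linarith
  have hf0 : ∀ k : ℕ, 0 ≤ cutPower θ x (w + k / n) := fun k => cutPower_nonneg hx _
  have hsplit : ∑ k ∈ Finset.Icc 1 n, cutPower θ x (w + k / n) =
      ∑ k ∈ Finset.Ico 1 l, cutPower θ x (w + k / n) +
      ∑ k ∈ Finset.Icc l n, cutPower θ x (w + k / n) :=
    (Finset.sum_Ico_consecutive _ hl (by lia : l ≤ n + 1)).symm
  have hterm : ∀ k ∈ Finset.Icc l n,
      (k / n : ℝ) * ((k : ℝ) + β)⁻¹ * cutPower θ x (w + k / n) =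
      (n : ℝ)⁻¹ * cutPower θ x (w + k / n) -
        (n : ℝ)⁻¹ * (β * ((k : ℝ) + β)⁻¹ * cutPower θ x (w + k / n)) := by
    intro k hk
    have hlk : l ≤ k := (Finset.mem_Icc.1 hk).1
    have hk0 : (0 : ℝ) < k := by exact_mod_cast hl.trans hlk
    have hkβ : 0 < (k : ℝ) + β := lt_of_lt_of_le (by positivity) (h k hlk)
    field_simp
    ring
  have hsmall0 : 0 ≤ ∑ k ∈ Finset.Ico 1 l, cutPower θ x (w + k / n) :=
    Finset.sum_nonneg fun k _ => hf0 k
  have hsmall : ∑ k ∈ Finset.Ico 1 l, cutPower θ x (w + k / n) ≤ (l - 1) * M := by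
    refine (Finset.sum_le_card_nsmul _ _ M fun k _ => hfM k).trans (le_of_eq ?_)
    rw [Nat.card_Ico, nsmul_eq_mul, Nat.cast_sub hl, Nat.cast_one]
  have hβsum : |∑ k ∈ Finset.Icc l n, β * ((k : ℝ) + β)⁻¹ * cutPower θ x (w + k / n)| ≤
      |β| / b * ∑ k ∈ Finset.Icc l n, (k : ℝ)⁻¹ * cutPower θ x (w + k / n) := by
    rw [Finset.mul_sum]
    refine (Finset.abs_sum_le_sum_abs _ _).trans (Finset.sum_le_sum fun k hk => ?_)
    have hlk : l ≤ k := (Finset.mem_Icc.1 hk).1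
    have hk0 : (0 : ℝ) < k := by exact_mod_cast hl.trans hlk
    have hkβ : 0 < (k : ℝ) + β := lt_of_lt_of_le (by positivity) (h k hlk)
    rw [abs_mul, abs_mul, abs_of_nonneg (hf0 k), abs_of_pos (inv_pos.2 hkβ), ← mul_assoc,
      div_mul_eq_mul_div, mul_div_assoc]
    refine mul_le_mul_of_nonneg_right (mul_le_mul_of_nonneg_left ?_ (abs_nonneg _)) (hf0 k)
    rw [le_div_iff₀ hb, inv_mul_le_iff₀ hkβ]
    field_simp
    exact h k hlk
  rw [Finset.sum_congr rfl hterm, Finset.sum_sub_distrib, ← Finset.mul_sum, ← Finset.mul_sum]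
  rw [hsplit, mul_add] at hR
  have e1 : (l / n : ℝ) * M = (n : ℝ)⁻¹ * ((l - 1) * M) + (n : ℝ)⁻¹ * M := by ring
  have e2 : |β| / b / n * ∑ k ∈ Finset.Icc l n, (k : ℝ)⁻¹ * cutPower θ x (w + k / n) =
      (n : ℝ)⁻¹ * (|β| / b *
        ∑ k ∈ Finset.Icc l n, (k : ℝ)⁻¹ * cutPower θ x (w + k / n)) := by ring
  rw [e1, e2]
  have b1 := mul_le_mul_of_nonneg_left hsmall hi.le
  have b2 := mul_nonneg hi.le hsmall0
  have b3 := mul_le_mul_of_nonneg_left (abs_le.1 hβsum).1 hi.le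
  have b4 := mul_le_mul_of_nonneg_left (abs_le.1 hβsum).2 hi.le
  obtain ⟨r1, r2⟩ := abs_le.1 hR
  rw [abs_le]
  constructor <;> linarith

theorem integrable_cutPower {μ : Measure ℝ} [IsFiniteMeasure μ] {θ x : ℝ} (hθ : 0 < θ)
    (hx : 0 < x) (c : ℝ) : Integrable (fun w => cutPower θ x (w + c)) μ := by
  refine Integrable.of_bound
    ((measurable_cutPower θ x).comp (measurable_add_const c)).aestronglyMeasurable x⁻¹
    (Filter.Eventually.of_forall fun w => ?_)
  rw [Real.norm_of_nonneg (cutPower_nonneg hx _)]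
  exact (cutPower_le hx _).trans (rpow_mul_max_rpow_le_inv hθ hx _)

theorem integrable_max_rpow_neg {μ : Measure ℝ} [IsFiniteMeasure μ] {x : ℝ} (hx : 0 < x)
    {a : ℝ} (ha : 0 ≤ a) : Integrable (fun w => max x w ^ (-a)) μ := by
  simpa using integrable_max_rpow (μ := μ) hx ha 0

/-! ### The Stein defect of the Poisson sum. -/

namespace IsPoissonFamily

variable {Ω : Type*} [MeasurableSpace Ω] {Pr : Measure Ω} {θ β : ℝ} {l n : ℕ} {P : ℕ → Ω → ℕ}

theorem isProbabilityMeasure_map (h : IsPoissonFamily Pr θ β l n P) [IsProbabilityMeasure Pr] :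
    IsProbabilityMeasure (Pr.map (weightedSum l n P)) :=
  Measure.isProbabilityMeasure_map h.aemeasurable_weightedSum

theorem ae_nonneg (h : IsPoissonFamily Pr θ β l n P) :
    ∀ᵐ w ∂(Pr.map (weightedSum l n P)), 0 ≤ w := by
  rw [ae_map_iff h.aemeasurable_weightedSum measurableSet_Ici]
  exact Filter.Eventually.of_forall (weightedSum_nonneg l n P)

theorem abs_dickmanTransform_sub_le (h : IsPoissonFamily Pr θ β l n P) [IsProbabilityMeasure Pr]
    (hθ : 0 < θ) (hβ : -β < (l : ℝ)) (hl : 1 ≤ l) (hln : l ≤ n) {b : ℝ} (hb : 0 < b)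
    (hbk : ∀ k : ℕ, l ≤ k → b * k ≤ k + β) {x : ℝ} (hx : 0 < x) :
    |(dickmanTransform θ (Pr.map (weightedSum l n P))).real (Set.Iic x) -
      (Pr.map (weightedSum l n P)).real (Set.Iic x)| ≤
    θ * (l / n * (x ^ θ * ∫ w, max x w ^ (-(θ + 1)) ∂(Pr.map (weightedSum l n P))) +
      |β| / b / n * ∑ k ∈ Finset.Icc l n, (k : ℝ)⁻¹ *
        ∫ w, cutPower θ x (w + k / n) ∂(Pr.map (weightedSum l n P))) := by
  have := h.isProbabilityMeasure_map
  have hnn := h.ae_nonneg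
  obtain ⟨hI, heq⟩ := h.integrable_integral_mul hθ hβ (measurable_cutPower θ x)
    (cutPower_nonneg hx) (M := x⁻¹)
    fun y _ => (cutPower_le hx _).trans (rpow_mul_max_rpow_le_inv hθ hx _)
  generalize Pr.map (weightedSum l n P) = μ at *
  have hI2 : Integrable (fun w => θ * ∫ u in (0 : ℝ)..1, cutPower θ x (w + u)) μ := by
    simp_rw [integral_cutPower hθ hx]
    exact ((integrable_max_rpow_neg hx hθ.le).const_mul _).sub
      ((integrable_max_rpow hx hθ.le 1).const_mul _)
  have hI3 : ∀ k : ℕ, Integrable (fun w => cutPower θ x (w + k / n)) μ := fun k =>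
    integrable_cutPower hθ hx _
  have hI4 : ∀ c : ℕ → ℝ, Integrable
      (fun w => ∑ k ∈ Finset.Icc l n, c k * cutPower θ x (w + k / n)) μ := fun c =>
    integrable_finsetSum _ fun k _ => (hI3 k).const_mul _
  have hI5 : ∀ c : ℕ → ℝ, ∫ w, ∑ k ∈ Finset.Icc l n, c k * cutPower θ x (w + k / n) ∂μ =
      ∑ k ∈ Finset.Icc l n, c k * ∫ w, cutPower θ x (w + k / n) ∂μ := fun c => by
    rw [integral_finsetSum _ fun k _ => (hI3 k).const_mul _]
    exact Finset.sum_congr rfl fun k _ => integral_const_mul _ _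
  have hI6 : Integrable (fun w => max x w ^ (-(θ + 1))) μ :=
    integrable_max_rpow_neg hx (by linarith)
  have hS : Integrable (fun w => θ *
      ∑ k ∈ Finset.Icc l n, (k / n : ℝ) * ((k : ℝ) + β)⁻¹ * cutPower θ x (w + k / n)) μ :=
    (hI4 _).const_mul θ
  rw [dickmanTransform_real_Iic_sub hθ hnn hx, integral_sub hI hI2, heq]
  have hrw : ∑ k ∈ Finset.Icc l n, (k / n : ℝ) * (θ / (k + β)) *
      ∫ w, cutPower θ x (w + k / n) ∂μ = ∫ w, θ *
      ∑ k ∈ Finset.Icc l n, (k / n : ℝ) * ((k : ℝ) + β)⁻¹ * cutPower θ x (w + k / n) ∂μ := by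
    rw [integral_const_mul, hI5, Finset.mul_sum]
    exact Finset.sum_congr rfl fun k _ => by ring
  have hfin : θ * (l / n * (x ^ θ * ∫ w, max x w ^ (-(θ + 1)) ∂μ) +
      |β| / b / n * ∑ k ∈ Finset.Icc l n, (k : ℝ)⁻¹ * ∫ w, cutPower θ x (w + k / n) ∂μ) =
      ∫ w, θ * (l / n * (x ^ θ * max x w ^ (-(θ + 1))) +
      |β| / b / n * ∑ k ∈ Finset.Icc l n, (k : ℝ)⁻¹ * cutPower θ x (w + k / n)) ∂μ := by
    rw [integral_const_mul, integral_add ((hI6.const_mul _).const_mul _) ((hI4 _).const_mul _),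
      integral_const_mul, integral_const_mul, integral_const_mul, hI5]
  rw [hrw, ← integral_sub hS hI2, hfin]
  refine abs_integral_le_integral_abs.trans (integral_mono (hS.sub hI2).abs
    ((((hI6.const_mul _).const_mul _).add ((hI4 _).const_mul _)).const_mul θ) fun w => ?_)
  simp only
  rw [← mul_sub, abs_mul, abs_of_pos hθ]
  refine mul_le_mul_of_nonneg_left ?_ hθ.le
  have := abs_weighted_sum_cutPower_sub_le hθ hx hb hl hln hbk w
  rwa [show -θ - 1 = -(θ + 1) by ring] at this

/-- For `y < 1`, with `m` the first integer above `ny`, all `P_k` with `k ≥ m` must vanish, which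
has probability at most a constant times `(m/(n+1))^θ`. Since `1 ≤ l ≤ ny`, one has `m ≤ 2ny`; this
is the origin of `2^θ`. For `y ≥ 1` the right side exceeds one. -/
theorem measureReal_Iic_le_rpow (h : IsPoissonFamily Pr θ β l n P) [IsProbabilityMeasure Pr]
    (hθ : 0 < θ) (hβ : -β < (l : ℝ)) (hl : 1 ≤ l) (hln : l ≤ n) {b : ℝ} (hb : 0 < b)
    (hbk : ∀ k : ℕ, l ≤ k → b * k ≤ k + β) {y : ℝ} (hy : (l : ℝ) / n ≤ y) :
    (Pr.map (weightedSum l n P)).real (Set.Iic y) ≤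
      2 ^ θ * Real.exp (θ * (|β| / b * ∑' k : ℕ, ((k : ℝ) ^ 2)⁻¹)) * y ^ θ := by
  have := h.isProbabilityMeasure_map
  have hn : 1 ≤ n := hl.trans hln
  have hn0 : (0 : ℝ) < n := by exact_mod_cast hn
  have hl0 : (0 : ℝ) < l := by exact_mod_cast hl
  have hy0 : 0 < y := lt_of_lt_of_le (by positivity) hy
  obtain ⟨A, hA⟩ : ∃ A, A = |β| / b * ∑' k : ℕ, ((k : ℝ) ^ 2)⁻¹ := ⟨_, rfl⟩
  have hA0 : 0 ≤ A := by rw [hA]; positivity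
  rw [← hA]
  have hlny : (l : ℝ) ≤ n * y := by
    rw [div_le_iff₀ hn0] at hy
    linarith
  rcases le_or_gt 1 y with hy1 | hy1
  · refine measureReal_le_one.trans ?_
    have h1 : (1 : ℝ) ≤ 2 ^ θ := Real.one_le_rpow one_le_two hθ.le
    have h2 : (1 : ℝ) ≤ Real.exp (θ * A) := Real.one_le_exp (by positivity)
    have h3 : (1 : ℝ) ≤ y ^ θ := Real.one_le_rpow hy1 hθ.le
    exact one_le_mul_of_one_le_of_one_le (one_le_mul_of_one_le_of_one_le h1 h2) h3
  · obtain ⟨m, hm⟩ : ∃ m, m = ⌊n * y⌋₊ + 1 := ⟨_, rfl⟩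
    have hny : 0 ≤ n * y := by positivity
    have hm1 : n * y < m := by
      rw [hm]
      push_cast
      exact Nat.lt_floor_add_one _
    have hm2 : (m : ℝ) ≤ n * y + 1 := by
      rw [hm]
      push_cast
      linarith [Nat.floor_le hny]
    have hlm : l ≤ m := by
      have : (l : ℝ) < m := lt_of_le_of_lt hlny hm1
      exact_mod_cast this.le
    have hmn : m ≤ n + 1 := by
      have : (m : ℝ) ≤ n + 1 := by nlinarith
      exact_mod_cast this
    have hm0 : (0 : ℝ) < m := lt_of_le_of_lt hny hm1
    refine (h.measureReal_Iic_le hθ hβ hn hlm hm1).trans ?_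
    have h1 := log_le_sum_Icc_inv (hl.trans hlm) hmn
    have h2 := (abs_le.1 (abs_sum_inv_add_sub_le hb hl hbk hlm (n := n))).1
    rw [← hA] at h2
    have h3 : ∑ k ∈ Finset.Icc m n, θ / (k + β) = θ * ∑ k ∈ Finset.Icc m n, ((k : ℝ) + β)⁻¹ := by
      rw [Finset.mul_sum]
      exact Finset.sum_congr rfl fun k _ => div_eq_mul_inv _ _
    rw [h3]
    have h4 : Real.log ((n + 1) / m) = - Real.log (m / (n + 1)) := by
      rw [← Real.log_inv, inv_div]
    calc Real.exp (-(θ * ∑ k ∈ Finset.Icc m n, ((k : ℝ) + β)⁻¹))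
        ≤ Real.exp (Real.log (m / (n + 1)) * θ + θ * A) := by
          rw [Real.exp_le_exp]
          nlinarith
      _ = (m / (n + 1)) ^ θ * Real.exp (θ * A) := by
          rw [Real.exp_add, Real.rpow_def_of_pos (by positivity)]
      _ ≤ (2 * y) ^ θ * Real.exp (θ * A) := by
          refine mul_le_mul_of_nonneg_right (Real.rpow_le_rpow (by positivity) ?_ hθ.le)
            (Real.exp_pos _).le
          rw [div_le_iff₀ (by positivity)]
          have : (1 : ℝ) ≤ l := by exact_mod_cast hl
          nlinarith
      _ = 2 ^ θ * Real.exp (θ * A) * y ^ θ := by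
          rw [Real.mul_rpow zero_le_two hy0.le]
          ring

end IsPoissonFamily

theorem max_eq_one_or (x : ℝ) : (x ≤ 1 ∧ max 1 x = 1) ∨ (1 ≤ x ∧ max 1 x = x) := by
  rcases le_total x 1 with h | h
  · exact Or.inl ⟨h, max_eq_left h⟩
  · exact Or.inr ⟨h, max_eq_right h⟩

/-- The exponent `-θ-1` is split as `-2θ` on `max(x,w)` and `θ-1` on `t`. With `t = k/n` the second
factor makes the harmonic sum converge, so that no logarithm appears for `θ < 1`. -/
theorem cutPower_add_le_mul_rpow {θ x w t : ℝ} (hθ : 0 < θ) (hθ1 : θ < 1) (hx : 0 < x)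
    (hw : 0 ≤ w) (ht : 0 < t) :
    cutPower θ x (w + t) ≤ x ^ θ * max x w ^ (-(2 * θ)) * t ^ (θ - 1) := by
  have hm : 0 < max x w := lt_max_of_lt_left hx
  have h1 : max x w ≤ max x (w + t) := max_le_max_left _ (by linarith)
  have h2 : t ≤ max x (w + t) := le_max_of_le_right (by linarith)
  refine (cutPower_le hx _).trans ?_
  rw [show -θ - 1 = -(2 * θ) + (θ - 1) by ring, Real.rpow_add (lt_max_of_lt_left hx), ← mul_assoc]
  refine mul_le_mul (mul_le_mul_of_nonneg_left
    (Real.rpow_le_rpow_of_nonpos hm h1 (by linarith)) (by positivity))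
    (Real.rpow_le_rpow_of_nonpos ht h2 (by linarith)) (by positivity) (by positivity)

namespace IsPoissonFamily

variable {Ω : Type*} [MeasurableSpace Ω] {Pr : Measure Ω} {θ β : ℝ} {l n : ℕ} {P : ℕ → Ω → ℕ}

theorem integrable_id (h : IsPoissonFamily Pr θ β l n P) [IsProbabilityMeasure Pr]
    (hθ : 0 < θ) (hβ : -β < (l : ℝ)) :
    Integrable (fun w => w) (Pr.map (weightedSum l n P)) := by
  simpa using (h.integrable_integral_mul hθ hβ (f := fun _ => 1) measurable_const
    (fun _ => zero_le_one) (M := 1) fun _ _ => le_rfl).1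

/-- Every term of the `β`-sum has its integral bounded by the same moment, and the harmonic sum
contributes `1 + log (n/l)`. This suffices for `θ ≥ 1`, and for `x ≥ 1` when `θ < 1`. -/
theorem abs_dickmanTransform_sub_le_log (h : IsPoissonFamily Pr θ β l n P)
    [IsProbabilityMeasure Pr]
    (hθ : 0 < θ) (hβ : -β < (l : ℝ)) (hl : 1 ≤ l) (hln : l ≤ n) {b : ℝ} (hb : 0 < b)
    (hbk : ∀ k : ℕ, l ≤ k → b * k ≤ k + β) {x : ℝ} (hx : 0 < x) :
    |(dickmanTransform θ (Pr.map (weightedSum l n P))).real (Set.Iic x) -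
      (Pr.map (weightedSum l n P)).real (Set.Iic x)| ≤
    θ * (1 + |β| / b + 1 / b) * ((l + |β| * Real.log (n / l)) / n) *
      (x ^ θ * ∫ w, max x w ^ (-(θ + 1)) ∂(Pr.map (weightedSum l n P))) := by
  refine (h.abs_dickmanTransform_sub_le hθ hβ hl hln hb hbk hx).trans ?_
  have := h.isProbabilityMeasure_map
  have hnn := h.ae_nonneg
  generalize Pr.map (weightedSum l n P) = μ at *
  have hn0 : (0 : ℝ) < n := by exact_mod_cast hl.trans hln
  have hl0 : (0 : ℝ) < l := by exact_mod_cast hl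
  have hl1 : (1 : ℝ) ≤ l := by exact_mod_cast hl
  have hlog : 0 ≤ Real.log (n / l) := Real.log_nonneg ((one_le_div hl0).2 (by exact_mod_cast hln))
  have hI6 : Integrable (fun w => max x w ^ (-(θ + 1))) μ :=
    integrable_max_rpow_neg hx (by linarith)
  obtain ⟨J, hJ⟩ : ∃ J, J = x ^ θ * ∫ w, max x w ^ (-(θ + 1)) ∂μ := ⟨_, rfl⟩
  have hJ0 : 0 ≤ J := by
    rw [hJ]
    exact mul_nonneg (by positivity)
      (integral_nonneg fun w => Real.rpow_nonneg (lt_max_of_lt_left hx).le _)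
  have hk : ∀ k : ℕ, ∫ w, cutPower θ x (w + k / n) ∂μ ≤ J := fun k => by
    rw [hJ, ← integral_const_mul]
    refine integral_mono (integrable_cutPower hθ hx _) (hI6.const_mul _) fun w => ?_
    have h0 : (0 : ℝ) ≤ k / n := by positivity
    have := (cutPower_le (θ := θ) hx (w + k / n)).trans
      (antitone_rpow_mul_max_rpow θ hx (by linarith) (by linarith : w ≤ w + k / n))
    rwa [show -θ - 1 = -(θ + 1) by ring] at this
  have hsum : ∑ k ∈ Finset.Icc l n, (k : ℝ)⁻¹ * ∫ w, cutPower θ x (w + k / n) ∂μ ≤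
      (1 + Real.log (n / l)) * J := by
    calc ∑ k ∈ Finset.Icc l n, (k : ℝ)⁻¹ * ∫ w, cutPower θ x (w + k / n) ∂μ
        ≤ ∑ k ∈ Finset.Icc l n, (k : ℝ)⁻¹ * J := by
          gcongr with k _
          exact hk k
      _ = (∑ k ∈ Finset.Icc l n, (k : ℝ)⁻¹) * J := (Finset.sum_mul _ _ _).symm
      _ ≤ _ := by
          gcongr
          exact sum_Icc_inv_le_log hl hln
  rw [← hJ]
  have hβ0 := abs_nonneg β
  have hbi : 0 < 1 / b := by positivity
  calc θ * (l / n * J + |β| / b / n * ∑ k ∈ Finset.Icc l n, (k : ℝ)⁻¹ *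
        ∫ w, cutPower θ x (w + k / n) ∂μ)
      ≤ θ * (l / n * J + |β| / b / n * ((1 + Real.log (n / l)) * J)) := by gcongr
    _ = θ * ((l + |β| / b * 1 + 1 / b * (|β| * Real.log (n / l))) / n) * J := by
        field_simp
        ring
    _ ≤ θ * ((1 + |β| / b + 1 / b) * (l + |β| * Real.log (n / l)) / n) * J := by
        have h1 : 0 ≤ |β| * Real.log (n / l) := by positivity
        have h2 : 0 ≤ |β| / b := by positivity
        gcongr
        nlinarith [mul_nonneg h2 h1, mul_nonneg hbi.le hl0.le]
    _ = _ := by ring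

theorem rpow_mul_integral_max_le_inv (h : IsPoissonFamily Pr θ β l n P) [IsProbabilityMeasure Pr]
    (hθ : 0 < θ) {x : ℝ} (hx : 0 < x) :
    x ^ θ * ∫ w, max x w ^ (-(θ + 1)) ∂(Pr.map (weightedSum l n P)) ≤ x⁻¹ := by
  have := h.isProbabilityMeasure_map
  rw [← integral_const_mul]
  calc ∫ w, x ^ θ * max x w ^ (-(θ + 1)) ∂(Pr.map (weightedSum l n P))
      ≤ ∫ w, x⁻¹ ∂(Pr.map (weightedSum l n P)) := by
        refine integral_mono ((integrable_max_rpow_neg hx (by linarith)).const_mul _)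
          (integrable_const _) fun w => ?_
        have := rpow_mul_max_rpow_le_inv hθ hx w
        rwa [show -θ - 1 = -(θ + 1) by ring] at this
    _ = x⁻¹ := by simp

/-- Below `l/n` no cancellation is needed: both distribution functions are at most their values at
`l/n`. -/
theorem abs_measureReal_Iic_sub_le_of_lt (h : IsPoissonFamily Pr θ β l n P)
    [IsProbabilityMeasure Pr]
    (hθ : 0 < θ) (hβ : -β < (l : ℝ)) (hl : 1 ≤ l) (hln : l ≤ n) {b : ℝ} (hb : 0 < b)
    (hbk : ∀ k : ℕ, l ≤ k → b * k ≤ k + β) {x : ℝ} (hx : x < (l : ℝ) / n) :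
    |(dickman θ).real (Set.Iic x) - (Pr.map (weightedSum l n P)).real (Set.Iic x)| * max 1 x ≤
      2 ^ θ * Real.exp (θ * (|β| / b * ∑' k : ℕ, ((k : ℝ) ^ 2)⁻¹)) * ((l : ℝ) / n) ^ θ := by
  have := h.isProbabilityMeasure_map
  have hD := isDickman_dickman hθ
  have := hD.isProbabilityMeasure
  have hn0 : (0 : ℝ) < n := by exact_mod_cast hl.trans hln
  have hl0 : (0 : ℝ) < l := by exact_mod_cast hl
  have hln1 : (l : ℝ) / n ≤ 1 := (div_le_one hn0).2 (by exact_mod_cast hln)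
  rw [max_eq_left (hx.le.trans hln1), mul_one]
  have hG := (measureReal_mono (μ := Pr.map (weightedSum l n P)) (Set.Iic_subset_Iic.2 hx.le)).trans
    (h.measureReal_Iic_le_rpow hθ hβ hl hln hb hbk le_rfl)
  have hF := (measureReal_mono (μ := dickman θ) (Set.Iic_subset_Iic.2 hx.le)).trans
    (hD.measureReal_Iic_le hθ (by positivity : (0 : ℝ) < l / n))
  have hF' : (dickman θ).real (Set.Iic x) ≤
      2 ^ θ * Real.exp (θ * (|β| / b * ∑' k : ℕ, ((k : ℝ) ^ 2)⁻¹)) * ((l : ℝ) / n) ^ θ := by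
    refine hF.trans (le_mul_of_one_le_left (by positivity) ?_)
    exact one_le_mul_of_one_le_of_one_le (Real.one_le_rpow one_le_two hθ.le)
      (Real.one_le_exp (by positivity))
  have h1 : 0 ≤ (dickman θ).real (Set.Iic x) := measureReal_nonneg
  have h2 : 0 ≤ (Pr.map (weightedSum l n P)).real (Set.Iic x) := measureReal_nonneg
  rw [abs_le]
  constructor <;> linarith

theorem rpow_mul_integral_max_le (h : IsPoissonFamily Pr θ β l n P) [IsProbabilityMeasure Pr]
    (hθ : 0 < θ) (hβ : -β < (l : ℝ)) (hl : 1 ≤ l) (hln : l ≤ n) {b : ℝ} (hb : 0 < b)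
    (hbk : ∀ k : ℕ, l ≤ k → b * k ≤ k + β) {x : ℝ} (hx : (l : ℝ) / n ≤ x) {a : ℝ} (ha : θ < a) :
    x ^ θ * ∫ w, max x w ^ (-a) ∂(Pr.map (weightedSum l n P)) ≤
      2 ^ θ * Real.exp (θ * (|β| / b * ∑' k : ℕ, ((k : ℝ) ^ 2)⁻¹)) * (a / (a - θ)) *
        x ^ (2 * θ - a) := by
  have := h.isProbabilityMeasure_map
  have hn0 : (0 : ℝ) < n := by exact_mod_cast hl.trans hln
  have hl0 : (0 : ℝ) < l := by exact_mod_cast hl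
  have hx0 : 0 < x := lt_of_lt_of_le (by positivity) hx
  refine (mul_le_mul_of_nonneg_left (integral_max_rpow_le (hθ.trans ha) ha hx0 (by positivity)
    fun y hy => h.measureReal_Iic_le_rpow hθ hβ hl hln hb hbk (hx.trans hy))
    (by positivity)).trans (le_of_eq ?_)
  rw [show 2 * θ - a = θ + (θ - a) by ring, Real.rpow_add hx0]
  ring

theorem sum_inv_mul_integral_cutPower_le (h : IsPoissonFamily Pr θ β l n P)
    [IsProbabilityMeasure Pr] (hθ : 0 < θ) (hθ1 : θ < 1) (hl : 1 ≤ l) (hln : l ≤ n)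
    {x : ℝ} (hx : 0 < x) :
    ∑ k ∈ Finset.Icc l n, (k : ℝ)⁻¹ *
        ∫ w, cutPower θ x (w + k / n) ∂(Pr.map (weightedSum l n P)) ≤
      (x ^ θ * ∫ w, max x w ^ (-(2 * θ)) ∂(Pr.map (weightedSum l n P))) *
        ((n : ℝ) ^ (1 - θ) * ∑' k : ℕ, (k : ℝ) ^ (θ - 2)) := by
  have := h.isProbabilityMeasure_map
  have hnn := h.ae_nonneg
  generalize Pr.map (weightedSum l n P) = μ at *
  have hn0 : (0 : ℝ) < n := by exact_mod_cast hl.trans hln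
  obtain ⟨J, hJ⟩ : ∃ J, J = x ^ θ * ∫ w, max x w ^ (-(2 * θ)) ∂μ := ⟨_, rfl⟩
  have hJ0 : 0 ≤ J := by
    rw [hJ]
    exact mul_nonneg (by positivity)
      (integral_nonneg fun w => Real.rpow_nonneg (lt_max_of_lt_left hx).le _)
  have hs : Summable fun k : ℕ => (k : ℝ) ^ (θ - 2) := Real.summable_nat_rpow.2 (by linarith)
  rw [← hJ]
  calc ∑ k ∈ Finset.Icc l n, (k : ℝ)⁻¹ * ∫ w, cutPower θ x (w + k / n) ∂μ
      ≤ ∑ k ∈ Finset.Icc l n, J * (n : ℝ) ^ (1 - θ) * (k : ℝ) ^ (θ - 2) := by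
        refine Finset.sum_le_sum fun k hk => ?_
        have hk0 : (0 : ℝ) < k := by exact_mod_cast hl.trans (Finset.mem_Icc.1 hk).1
        have h1 : ∫ w, cutPower θ x (w + k / n) ∂μ ≤ J * ((k : ℝ) / n) ^ (θ - 1) := by
          rw [hJ, ← integral_const_mul, ← integral_mul_const]
          refine integral_mono_ae (integrable_cutPower hθ hx _)
            (((integrable_max_rpow_neg hx (by linarith)).const_mul _).mul_const _) ?_
          filter_upwards [hnn] with w hw
          exact cutPower_add_le_mul_rpow hθ hθ1 hx hw (by positivity)
        refine (mul_le_mul_of_nonneg_left h1 (by positivity)).trans (le_of_eq ?_)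
        rw [Real.div_rpow hk0.le hn0.le, show 1 - θ = -(θ - 1) by ring, Real.rpow_neg hn0.le,
          show θ - 2 = (θ - 1) - 1 by ring, Real.rpow_sub_one hk0.ne' (θ - 1)]
        field_simp
    _ = J * (n : ℝ) ^ (1 - θ) * ∑ k ∈ Finset.Icc l n, (k : ℝ) ^ (θ - 2) :=
        (Finset.mul_sum _ _ _).symm
    _ ≤ J * (n : ℝ) ^ (1 - θ) * ∑' k : ℕ, (k : ℝ) ^ (θ - 2) := by
        gcongr
        exact hs.sum_le_tsum _ fun k _ => by positivity
    _ = _ := by ring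

end IsPoissonFamily

/-! ### The upper bounds. -/

theorem exists_upper_bound_of_one_le {θ : ℝ} (β : ℝ) (hθ : 1 ≤ θ) : ∃ C : ℝ, 0 < C ∧
    ∀ l n : ℕ, 1 ≤ l → -β < (l : ℝ) → l ≤ n →
      ∀ (Ω : Type*) [MeasurableSpace Ω] (Pr : Measure Ω) [IsProbabilityMeasure Pr]
        (P : ℕ → Ω → ℕ), IsPoissonFamily Pr θ β l n P →
        kolmogorovDist (Pr.map (weightedSum l n P)) (dickman θ) ≤
          C * (((l : ℝ) + |β| * Real.log ((n : ℝ) / (l : ℝ))) / (n : ℝ)) := by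
  have hθ0 : 0 < θ := by linarith
  obtain ⟨K, hK, hKb⟩ := exists_kolmogorov_bound hθ0
  obtain ⟨b, hb, hbk⟩ := exists_mul_le_add β
  obtain ⟨C₀, hC₀⟩ : ∃ C₀, C₀ = 2 ^ θ *
    Real.exp (θ * (|β| / b * ∑' k : ℕ, ((k : ℝ) ^ 2)⁻¹)) := ⟨_, rfl⟩
  obtain ⟨C₁, hC₁⟩ : ∃ C₁, C₁ = θ * (1 + |β| / b + 1 / b) := ⟨_, rfl⟩
  have hC₀0 : 0 < C₀ := by rw [hC₀]; positivity
  have hC₁0 : 0 < C₁ := by rw [hC₁]; positivity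
  refine ⟨K * (C₀ + C₁ * (1 + C₀ * (θ + 1))), by positivity,
    fun l n hl hlβ hln Ω _ Pr _ P h => ?_⟩
  have := h.isProbabilityMeasure_map
  have hn0 : (0 : ℝ) < n := by exact_mod_cast hl.trans hln
  have hl0 : (0 : ℝ) < l := by exact_mod_cast hl
  have hln1 : (l : ℝ) / n ≤ 1 := (div_le_one hn0).2 (by exact_mod_cast hln)
  have hlog : 0 ≤ Real.log (n / l) := Real.log_nonneg ((one_le_div hl0).2 (by exact_mod_cast hln))
  have hbk' := fun k hk => hbk l k hl hlβ hk
  obtain ⟨ε, hε⟩ : ∃ ε, ε = ((l : ℝ) + |β| * Real.log ((n : ℝ) / (l : ℝ))) / (n : ℝ) := ⟨_, rfl⟩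
  have hε0 : 0 < ε := by rw [hε]; positivity
  have hlε : (l : ℝ) / n ≤ ε := by
    rw [hε]
    gcongr
    have : 0 ≤ |β| * Real.log ((n : ℝ) / (l : ℝ)) := by positivity
    linarith
  rw [← hε, mul_assoc]
  refine hKb _ h.ae_nonneg (h.integrable_id hθ0 hlβ) _ (by positivity) fun x hx => ?_
  have hsplit : (C₀ + C₁ * (1 + C₀ * (θ + 1))) * ε =
      C₀ * ε + C₁ * ε + C₁ * ε * (C₀ * (θ + 1)) := by ring
  have t1 : 0 ≤ C₀ * ε := by positivity
  have t2 : 0 ≤ C₁ * ε := by positivity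
  have t3 : 0 ≤ C₁ * ε * (C₀ * (θ + 1)) := by positivity
  rcases lt_or_ge x (l / n) with hxl | hxl
  · left
    refine (h.abs_measureReal_Iic_sub_le_of_lt hθ0 hlβ hl hln hb hbk' hxl).trans ?_
    rw [← hC₀, hsplit]
    have h1 : ((l : ℝ) / n) ^ θ ≤ l / n := by
      simpa using Real.rpow_le_rpow_of_exponent_ge (by positivity) hln1 hθ
    have h2 := mul_le_mul_of_nonneg_left (h1.trans hlε) hC₀0.le
    linarith
  · right
    have hx0 : 0 < x := lt_of_lt_of_le (by positivity) hxl
    refine ⟨hx0, ?_⟩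
    have hmain := h.abs_dickmanTransform_sub_le_log hθ0 hlβ hl hln hb hbk' hx0
    rw [← hC₁, ← hε] at hmain
    rw [hsplit]
    rcases max_eq_one_or x with ⟨hx1, hm⟩ | ⟨hx1, hm⟩ <;> rw [hm]
    -- The moment is at most a constant times `x^(2θ-(θ+1)) = x^(θ-1)`, and this power is bounded on
    -- `(0,1]` exactly because `θ ≥ 1`.
    · have hJ := h.rpow_mul_integral_max_le hθ0 hlβ hl hln hb hbk' hxl (a := θ + 1) (by linarith)
      rw [← hC₀, add_sub_cancel_left, div_one] at hJ
      have h1 : x ^ (2 * θ - (θ + 1)) ≤ 1 := Real.rpow_le_one hx0.le hx1 (by linarith)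
      have h2 := hJ.trans (mul_le_of_le_one_right (by positivity) h1)
      have h3 := mul_le_mul_of_nonneg_left h2 t2
      linarith
    -- For `x ≥ 1` the trivial moment bound `1/x` cancels the factor `max 1 x`.
    · have h2 := mul_le_mul_of_nonneg_left (h.rpow_mul_integral_max_le_inv hθ0 hx0) t2
      have h3 := mul_le_mul_of_nonneg_right (hmain.trans h2) hx0.le
      rw [mul_assoc, inv_mul_cancel₀ hx0.ne', mul_one] at h3
      linarith

theorem exists_upper_bound_of_lt_one {θ : ℝ} (β : ℝ) (hθ0 : 0 < θ) (hθ : θ < 1) : ∃ C : ℝ, 0 < C ∧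
    ∀ l n : ℕ, 1 ≤ l → -β < (l : ℝ) → l ≤ n →
      ∀ (Ω : Type*) [MeasurableSpace Ω] (Pr : Measure Ω) [IsProbabilityMeasure Pr]
        (P : ℕ → Ω → ℕ), IsPoissonFamily Pr θ β l n P →
        kolmogorovDist (Pr.map (weightedSum l n P)) (dickman θ) ≤
          C * (l : ℝ) ^ θ / (n : ℝ) ^ θ := by
  obtain ⟨K, hK, hKb⟩ := exists_kolmogorov_bound hθ0
  obtain ⟨b, hb, hbk⟩ := exists_mul_le_add β
  obtain ⟨C₀, hC₀⟩ : ∃ C₀, C₀ = 2 ^ θ *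
    Real.exp (θ * (|β| / b * ∑' k : ℕ, ((k : ℝ) ^ 2)⁻¹)) := ⟨_, rfl⟩
  obtain ⟨C₁, hC₁⟩ : ∃ C₁, C₁ = θ * (1 + |β| / b + 1 / b) := ⟨_, rfl⟩
  obtain ⟨Z, hZ⟩ : ∃ Z, Z = ∑' k : ℕ, (k : ℝ) ^ (θ - 2) := ⟨_, rfl⟩
  have hC₀0 : 0 < C₀ := by rw [hC₀]; positivity
  have hC₁0 : 0 < C₁ := by rw [hC₁]; positivity
  have hZ0 : 0 ≤ Z := by
    rw [hZ]
    exact tsum_nonneg fun k => by positivity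
  have h1θ : 0 < 1 - θ := by linarith
  refine ⟨K * (C₀ + C₁ * (1 + |β| / (1 - θ)) + θ * (C₀ * (θ + 1) + |β| / b * (C₀ * 2 * Z))),
    by positivity, fun l n hl hlβ hln Ω _ Pr _ P h => ?_⟩
  have := h.isProbabilityMeasure_map
  have hn0 : (0 : ℝ) < n := by exact_mod_cast hl.trans hln
  have hl0 : (0 : ℝ) < l := by exact_mod_cast hl
  have hl1 : (1 : ℝ) ≤ l := by exact_mod_cast hl
  have hln1 : (l : ℝ) / n ≤ 1 := (div_le_one hn0).2 (by exact_mod_cast hln)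
  have hlog : 0 ≤ Real.log (n / l) := Real.log_nonneg ((one_le_div hl0).2 (by exact_mod_cast hln))
  have hbk' := fun k hk => hbk l k hl hlβ hk
  obtain ⟨ε, hε⟩ : ∃ ε, ε = ((l : ℝ) / n) ^ θ := ⟨_, rfl⟩
  have hε0 : 0 < ε := by rw [hε]; positivity
  have hpow : (l : ℝ) / n * ((l : ℝ) / n) ^ (θ - 1) = ε := by
    rw [hε, Real.rpow_sub_one (by positivity)]
    field_simp
  have hlε : (l : ℝ) / n ≤ ε := by
    rw [hε]
    simpa using Real.rpow_le_rpow_of_exponent_ge (by positivity) hln1 hθ.le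
  have hnε : (n : ℝ) ^ (1 - θ) / n ≤ ε := by
    rw [Real.rpow_sub hn0, Real.rpow_one, div_div, mul_comm, ← div_div, div_self hn0.ne', hε,
      Real.div_rpow hl0.le hn0.le]
    gcongr
    exact Real.one_le_rpow hl1 hθ0.le
  -- A logarithm is dominated by the power `1-θ`; this is needed only for `x ≥ 1`, where the
  -- logarithmic estimate is used.
  have hlogε : (l + |β| * Real.log (n / l)) / n ≤ (1 + |β| / (1 - θ)) * ε := by
    have h1 : Real.log (n / l) ≤ ((n : ℝ) / l) ^ (1 - θ) / (1 - θ) :=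
      Real.log_le_rpow_div (by positivity) h1θ
    have h2 : ((n : ℝ) / l) ^ (1 - θ) = ((l : ℝ) / n) ^ (θ - 1) := by
      rw [← inv_div, Real.inv_rpow (by positivity), ← Real.rpow_neg (by positivity), neg_sub]
    have h3 : ((l : ℝ) / n) ^ (θ - 1) / n ≤ ε := by
      rw [← hpow, div_eq_inv_mul]
      gcongr
      rw [inv_eq_one_div]
      gcongr
    calc (l + |β| * Real.log (n / l)) / n
        ≤ (l + |β| * (((l : ℝ) / n) ^ (θ - 1) / (1 - θ))) / n := by
          rw [← h2]
          gcongr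
      _ = l / n + |β| / (1 - θ) * (((l : ℝ) / n) ^ (θ - 1) / n) := by ring
      _ ≤ ε + |β| / (1 - θ) * ε := by gcongr
      _ = _ := by ring
  rw [mul_div_assoc, ← Real.div_rpow hl0.le hn0.le, ← hε, mul_assoc]
  refine hKb _ h.ae_nonneg (h.integrable_id hθ0 hlβ) _ (by positivity) fun x hx => ?_
  have hsplit : (C₀ + C₁ * (1 + |β| / (1 - θ)) + θ * (C₀ * (θ + 1) + |β| / b * (C₀ * 2 * Z))) * ε =
      C₀ * ε + C₁ * ((1 + |β| / (1 - θ)) * ε) +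
        θ * (C₀ * (θ + 1) * ε + |β| / b * (C₀ * 2 * Z * ε)) := by ring
  have t1 : 0 ≤ C₀ * ε := by positivity
  have t2 : 0 ≤ C₁ * ((1 + |β| / (1 - θ)) * ε) := by positivity
  have t3 : 0 ≤ θ * (C₀ * (θ + 1) * ε + |β| / b * (C₀ * 2 * Z * ε)) := by positivity
  rw [hsplit]
  rcases lt_or_ge x (l / n) with hxl | hxl
  · left
    refine (h.abs_measureReal_Iic_sub_le_of_lt hθ0 hlβ hl hln hb hbk' hxl).trans ?_
    rw [← hC₀, ← hε]
    linarith
  · right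
    have hx0 : 0 < x := lt_of_lt_of_le (by positivity) hxl
    refine ⟨hx0, ?_⟩
    rcases max_eq_one_or x with ⟨hx1, hm⟩ | ⟨hx1, hm⟩ <;> rw [hm]
    · have hJ := h.rpow_mul_integral_max_le hθ0 hlβ hl hln hb hbk' hxl (a := θ + 1) (by linarith)
      rw [← hC₀, add_sub_cancel_left, div_one, show 2 * θ - (θ + 1) = θ - 1 by ring] at hJ
      -- With `a = 2θ` the power of `x` disappears, leaving a bound uniform in `x`.
      have hJ2 := h.rpow_mul_integral_max_le hθ0 hlβ hl hln hb hbk' hxl (a := 2 * θ) (by linarith)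
      rw [← hC₀, sub_self, Real.rpow_zero, mul_one, show 2 * θ / (2 * θ - θ) = 2 by
        field_simp; ring] at hJ2
      have hmain := h.abs_dickmanTransform_sub_le hθ0 hlβ hl hln hb hbk' hx0
      have hsum := h.sum_inv_mul_integral_cutPower_le hθ0 hθ hl hln hx0
      rw [← hZ] at hsum
      have hxpow : x ^ (θ - 1) ≤ ((l : ℝ) / n) ^ (θ - 1) :=
        Real.rpow_le_rpow_of_nonpos (by positivity) hxl (by linarith)
      have s1 : l / n * (x ^ θ * ∫ w, max x w ^ (-(θ + 1)) ∂(Pr.map (weightedSum l n P))) ≤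
          C₀ * (θ + 1) * ε := by
        calc _ ≤ (l : ℝ) / n * (C₀ * (θ + 1) * ((l : ℝ) / n) ^ (θ - 1)) := by
              refine mul_le_mul_of_nonneg_left (hJ.trans ?_) (by positivity)
              gcongr
          _ = C₀ * (θ + 1) * ((l : ℝ) / n * ((l : ℝ) / n) ^ (θ - 1)) := by ring
          _ = _ := by rw [hpow]
      have s2 : |β| / b / n * ∑ k ∈ Finset.Icc l n, (k : ℝ)⁻¹ *
          ∫ w, cutPower θ x (w + k / n) ∂(Pr.map (weightedSum l n P)) ≤
          |β| / b * (C₀ * 2 * Z * ε) := by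
        calc _ ≤ |β| / b / n * (C₀ * 2 * ((n : ℝ) ^ (1 - θ) * Z)) := by
              refine mul_le_mul_of_nonneg_left (hsum.trans ?_) (by positivity)
              gcongr
          _ = |β| / b * (C₀ * 2 * Z * ((n : ℝ) ^ (1 - θ) / n)) := by ring
          _ ≤ _ := by gcongr
      have s3 := mul_le_mul_of_nonneg_left (add_le_add s1 s2) hθ0.le
      linarith
    · have hmain := h.abs_dickmanTransform_sub_le_log hθ0 hlβ hl hln hb hbk' hx0
      rw [← hC₁] at hmain
      have h1 : 0 ≤ C₁ * ((l + |β| * Real.log (n / l)) / n) := by positivity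
      have h2 := mul_le_mul_of_nonneg_left (h.rpow_mul_integral_max_le_inv hθ0 hx0) h1
      have h3 := mul_le_mul_of_nonneg_right (hmain.trans h2) hx0.le
      rw [mul_assoc, inv_mul_cancel₀ hx0.ne', mul_one] at h3
      have h4 := mul_le_mul_of_nonneg_left hlogε hC₁0.le
      linarith

/-! ### Smooth test functions and the Kolmogorov distance. -/

theorem abs_measureReal_Iic_sub_le_kolmogorovDist (μ ν : Measure ℝ) [IsProbabilityMeasure μ]
    [IsProbabilityMeasure ν] {a : ℝ} (ha : 0 ≤ a) :
    |μ.real (Set.Iic a) - ν.real (Set.Iic a)| ≤ kolmogorovDist μ ν :=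
  le_ciSup (bddAbove_kolmogorovDist μ ν) (⟨a, ha⟩ : Set.Ici (0 : ℝ))

/-- Fubini on `{w ≤ t}`, an integration by parts against the distribution function; no regularity of
`q` is used beyond being an integral of `q'`. -/
theorem integral_eq_neg_integral_deriv_mul_cdf {μ : Measure ℝ} [IsProbabilityMeasure μ]
    (hμ : ∀ᵐ w ∂μ, 0 ≤ w) {q q' : ℝ → ℝ} (hq' : IntegrableOn q' (Set.Ioi 0))
    (hq : ∀ y, 0 ≤ y → q y = -∫ t in Set.Ioi y, q' t) :
    IntegrableOn (fun t => q' t * μ.real (Set.Iic t)) (Set.Ioi 0) ∧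
    ∫ w, q w ∂μ = -∫ t in Set.Ioi 0, q' t * μ.real (Set.Iic t) := by
  have hset : MeasurableSet {p : ℝ × ℝ | p.1 ≤ p.2} := measurableSet_le measurable_fst measurable_snd
  have hI : Integrable ({p : ℝ × ℝ | p.1 ≤ p.2}.indicator fun p => q' p.2)
      (μ.prod (volume.restrict (Set.Ioi 0))) :=
    (Integrable.comp_snd hq' μ).indicator hset
  have hin : ∀ t, ∫ w, {p : ℝ × ℝ | p.1 ≤ p.2}.indicator (fun p => q' p.2) (w, t) ∂μ =
      q' t * μ.real (Set.Iic t) := by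
    intro t
    have : (fun w => {p : ℝ × ℝ | p.1 ≤ p.2}.indicator (fun p => q' p.2) (w, t)) =
        (Set.Iic t).indicator fun _ => q' t := by
      ext w
      simp [Set.indicator]
    rw [this, integral_indicator_const _ measurableSet_Iic, smul_eq_mul, mul_comm]
  constructor
  · have := hI.integral_prod_right
    simp only [hin] at this
    exact this
  · calc ∫ w, q w ∂μ = ∫ w, (-∫ t in Set.Ioi 0,
          {p : ℝ × ℝ | p.1 ≤ p.2}.indicator (fun p => q' p.2) (w, t)) ∂μ := by
          refine integral_congr_ae ?_
          filter_upwards [hμ] with w hw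
          have : (fun t => {p : ℝ × ℝ | p.1 ≤ p.2}.indicator (fun p => q' p.2) (w, t)) =
              (Set.Ici w).indicator q' := by
            ext t
            simp [Set.indicator]
          rw [hq w hw, this, setIntegral_indicator measurableSet_Ici]
          have hE : Set.Ioi w = Set.Ioi 0 ∩ Set.Ioi w :=
            (Set.inter_eq_right.2 (Set.Ioi_subset_Ioi hw)).symm
          congr 1
          conv_lhs => rw [hE]
          exact setIntegral_congr_set (ae_eq_set_inter (ae_eq_refl _) Ioi_ae_eq_Ici)
      _ = _ := by
          rw [integral_neg]
          have := integral_integral_swap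
            (f := fun w t => {p : ℝ × ℝ | p.1 ≤ p.2}.indicator (fun p => q' p.2) (w, t)) hI
          rw [this]
          simp only [hin]

theorem abs_integral_sub_le_kolmogorovDist {μ ν : Measure ℝ} [IsProbabilityMeasure μ]
    [IsProbabilityMeasure ν] (hμ : ∀ᵐ w ∂μ, 0 ≤ w) (hν : ∀ᵐ w ∂ν, 0 ≤ w) {q q' : ℝ → ℝ}
    (hq' : IntegrableOn q' (Set.Ioi 0)) (hq : ∀ y, 0 ≤ y → q y = -∫ t in Set.Ioi y, q' t) :
    |∫ w, q w ∂μ - ∫ w, q w ∂ν| ≤ (∫ t in Set.Ioi 0, |q' t|) * kolmogorovDist μ ν := by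
  obtain ⟨h1, h2⟩ := integral_eq_neg_integral_deriv_mul_cdf hμ hq' hq
  obtain ⟨g1, g2⟩ := integral_eq_neg_integral_deriv_mul_cdf hν hq' hq
  have hsub : IntegrableOn (fun t => q' t * ν.real (Set.Iic t) - q' t * μ.real (Set.Iic t))
      (Set.Ioi 0) := g1.sub h1
  rw [h2, g2, neg_sub_neg, ← integral_sub g1 h1, ← integral_mul_const]
  refine abs_integral_le_integral_abs.trans
    (setIntegral_mono_on hsub.abs (hq'.abs.mul_const _) measurableSet_Ioi fun t ht => ?_)
  rw [← mul_sub, abs_mul, abs_sub_comm]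
  exact mul_le_mul_of_nonneg_left
    (abs_measureReal_Iic_sub_le_kolmogorovDist μ ν (le_of_lt ht)) (abs_nonneg _)

theorem integrableOn_sub_mul_exp_neg (c : ℝ) :
    IntegrableOn (fun t : ℝ => (c - t) * Real.exp (-t)) (Set.Ioi 0) := by
  refine Integrable.mono' ((exp_neg_integrableOn_Ioi 0 (b := 1 / 2) (by norm_num)).const_mul
    (|c| + 2)) (by fun_prop) ?_
  filter_upwards [ae_restrict_mem measurableSet_Ioi] with t ht
  have ht0 : 0 < t := ht
  have h1 : Real.exp (-t) = Real.exp (-(1 / 2) * t) * Real.exp (-(1 / 2) * t) := by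
    rw [← Real.exp_add]
    congr 1
    ring
  have h2 := mul_exp_neg_mul_le (s := 1 / 2) (z := t) (by norm_num)
  rw [show -(1 / 2 * t) = -(1 / 2) * t by ring] at h2
  have h3 : Real.exp (-(1 / 2) * t) ≤ 1 := Real.exp_le_one_iff.2 (by linarith)
  have h4 : |c - t| ≤ |c| + t := by
    refine (abs_sub _ _).trans ?_
    rw [abs_of_pos ht0]
  rw [norm_mul, Real.norm_eq_abs, Real.norm_of_nonneg (Real.exp_pos _).le, h1, ← mul_assoc]
  refine mul_le_mul_of_nonneg_right ?_ (Real.exp_pos _).le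
  calc |c - t| * Real.exp (-(1 / 2) * t) ≤ (|c| + t) * Real.exp (-(1 / 2) * t) := by gcongr
    _ = |c| * Real.exp (-(1 / 2) * t) + t * Real.exp (-(1 / 2) * t) := by ring
    _ ≤ |c| * 1 + 2 := by
        gcongr
        linarith
    _ = |c| + 2 := by ring

theorem sub_mul_exp_neg_eq (c : ℝ) {y : ℝ} (hy : 0 ≤ y) :
    (y - c) * Real.exp (-y) = -∫ t in Set.Ioi y, (1 + c - t) * Real.exp (-t) := by
  rw [integral_Ioi_of_hasDerivAt_of_tendsto' (f := fun t => (t - c) * Real.exp (-t)) (m := 0)]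
  · ring
  · intro t _
    convert! ((hasDerivAt_id t).sub_const c).mul (hasDerivAt_neg t).exp using 1
    simp only [id]
    ring
  · exact (integrableOn_sub_mul_exp_neg (1 + c)).mono_set (Set.Ioi_subset_Ioi hy)
  · have h1 := Real.tendsto_pow_mul_exp_neg_atTop_nhds_zero 1
    have h2 := (Real.tendsto_exp_neg_atTop_nhds_zero).const_mul c
    have := h1.sub h2
    rw [mul_zero, sub_zero] at this
    refine this.congr fun t => ?_
    ring

/-- The Laplace identity at `s = 1` says that this test function has Dickman mean zero, so its mean
under `μ` alone is bounded by the distance. -/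
theorem exists_kolmogorovDist_ge {θ : ℝ} (hθ : 0 < θ) : ∃ L : ℝ, 0 < L ∧
    ∀ (μ : Measure ℝ) [IsProbabilityMeasure μ], (∀ᵐ w ∂μ, 0 ≤ w) →
      |∫ w, (w - θ * (1 - Real.exp (-1))) * Real.exp (-w) ∂μ| ≤
        L * kolmogorovDist μ (dickman θ) := by
  have hD := isDickman_dickman hθ
  have := hD.isProbabilityMeasure
  obtain ⟨c, hc⟩ : ∃ c, c = θ * (1 - Real.exp (-1)) := ⟨_, rfl⟩
  -- Adding one makes the constant positive without evaluating the integral.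
  refine ⟨(∫ t in Set.Ioi 0, |(1 + c - t) * Real.exp (-t)|) + 1, ?_, fun μ _ hμ => ?_⟩
  · have : 0 ≤ ∫ t in Set.Ioi (0 : ℝ), |(1 + c - t) * Real.exp (-t)| :=
      integral_nonneg fun _ => abs_nonneg _
    linarith
  · have h := abs_integral_sub_le_kolmogorovDist hμ hD.nonneg
      (integrableOn_sub_mul_exp_neg (1 + c)) fun y hy => sub_mul_exp_neg_eq c hy
    obtain ⟨i1, i2, e⟩ := hD.integral_mul_exp hθ one_pos
    simp only [one_mul] at i1 i2 e
    have h0 : ∫ w, (w - c) * Real.exp (-w) ∂(dickman θ) = 0 := by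
      simp only [sub_mul]
      rw [integral_sub i1 (i2.const_mul c), integral_const_mul, e, hc, sub_self]
    rw [h0, sub_zero] at h
    rw [← hc]
    refine h.trans (mul_le_mul_of_nonneg_right (by linarith) ?_)
    exact (abs_nonneg _).trans (abs_measureReal_Iic_sub_le_kolmogorovDist μ (dickman θ) le_rfl)

/-- A quantitative strict gap of order `1/n` between the Riemann sum and the integral; it provides
the lower bound when `β = 0`. The sum is geometric. -/
theorem sum_exp_neg_div_le {n : ℕ} (hn : 1 ≤ n) :
    (n : ℝ)⁻¹ * ∑ k ∈ Finset.Icc 1 n, Real.exp (-(k / n : ℝ)) ≤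
      (1 - Real.exp (-1)) * (1 - 1 / (3 * n)) := by
  have hn1 : (1 : ℝ) ≤ n := by exact_mod_cast hn
  have hn0 : (0 : ℝ) < n := by linarith
  obtain ⟨r, hr⟩ : ∃ r, r = Real.exp (-(1 / n : ℝ)) := ⟨_, rfl⟩
  have hrk : ∀ k : ℕ, Real.exp (-(k / n : ℝ)) = r ^ k := fun k => by
    rw [hr, ← Real.exp_nat_mul]
    congr 1
    ring
  have hrn : r ^ n = Real.exp (-1) := by
    rw [← hrk, div_self hn0.ne']
  have hsum : ∑ k ∈ Finset.Icc 1 n, r ^ k = r * ∑ i ∈ Finset.range n, r ^ i := by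
    rw [Finset.mul_sum, Finset.range_eq_Ico, Finset.sum_congr rfl fun i _ => (pow_succ' r i).symm,
      Finset.sum_Ico_add' (fun i : ℕ => r ^ i) 0 n 1]
    rfl
  have hgeom := mul_neg_geom_sum r n
  rw [hrn] at hgeom
  have hr0 : 0 < r := by rw [hr]; exact Real.exp_pos _
  have hquad := Real.quadratic_le_exp_of_nonneg (x := 1 / (n : ℝ)) (by positivity)
  have hrinv : Real.exp (1 / n : ℝ) = r⁻¹ := by rw [hr, ← Real.exp_neg, neg_neg]
  rw [hrinv] at hquad
  have hE : 0 < 1 - Real.exp (-1) := by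
    have := Real.exp_lt_one_iff.2 (by norm_num : (-1 : ℝ) < 0)
    linarith
  simp only [hrk]
  rw [hsum]
  obtain ⟨S, hS⟩ : ∃ S, S = ∑ i ∈ Finset.range n, r ^ i := ⟨_, rfl⟩
  rw [← hS] at hgeom ⊢
  have hS0 : 0 < S := by
    rw [hS]
    exact Finset.sum_pos (fun i _ => by positivity) ⟨0, Finset.mem_range.2 hn⟩
  have hmul : (1 + 1 / (n : ℝ) + (1 / n) ^ 2 / 2) * r ≤ 1 := by
    calc _ ≤ r⁻¹ * r := by gcongr
      _ = 1 := inv_mul_cancel₀ hr0.ne'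
  rw [← hgeom]
  -- With `t = 1/n`, `e^t ≥ 1 + t + t²/2` gives `1 - r ≥ r (t + t²/2)`, and `(t + t²/2)(1 - t/3) ≥
  -- t` for `t ≤ 1`.
  have key : (n : ℝ)⁻¹ * r ≤ (1 - r) * (1 - 1 / (3 * n)) := by
    obtain ⟨t, ht⟩ : ∃ t, t = (n : ℝ)⁻¹ := ⟨_, rfl⟩
    have ht0 : 0 < t := by rw [ht]; positivity
    have ht1 : t ≤ 1 := by rw [ht]; exact inv_le_one_of_one_le₀ hn1
    have e1 : 1 / (3 * (n : ℝ)) = t / 3 := by rw [ht]; field_simp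
    rw [one_div, ← ht] at hmul
    rw [← ht, e1]
    have h1 : r * (t + t ^ 2 / 2) ≤ 1 - r := by linarith
    have h2 : r * t ≤ r * (t + t ^ 2 / 2) * (1 - t / 3) := by
      have : t ≤ (t + t ^ 2 / 2) * (1 - t / 3) := by nlinarith [mul_pos ht0 ht0]
      nlinarith
    have h3 := mul_le_mul_of_nonneg_right h1 (by linarith : 0 ≤ 1 - t / 3)
    linarith
  calc (n : ℝ)⁻¹ * (r * S) = (n : ℝ)⁻¹ * r * S := by ring
    _ ≤ (1 - r) * (1 - 1 / (3 * n)) * S := by gcongr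
    _ = _ := by ring

/-! ### The lower bounds. -/

namespace IsPoissonFamily

variable {Ω : Type*} [MeasurableSpace Ω] {Pr : Measure Ω} {θ β : ℝ} {l n : ℕ} {P : ℕ → Ω → ℕ}

theorem integral_sub_mul_exp_neg (h : IsPoissonFamily Pr θ β l n P) [IsProbabilityMeasure Pr]
    (hθ : 0 < θ) (hβ : -β < (l : ℝ)) :
    ∫ w, (w - θ * (1 - Real.exp (-1))) * Real.exp (-w) ∂(Pr.map (weightedSum l n P)) =
      θ * (∫ w, Real.exp (-w) ∂(Pr.map (weightedSum l n P))) *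
      (∑ k ∈ Finset.Icc l n, (k / n : ℝ) * ((k : ℝ) + β)⁻¹ * Real.exp (-(k / n : ℝ)) -
        (1 - Real.exp (-1))) := by
  have := h.isProbabilityMeasure_map
  have hnn := h.ae_nonneg
  obtain ⟨h1, h2⟩ := h.integrable_integral_mul hθ hβ (f := fun y => Real.exp (-y)) (by fun_prop)
    (fun y => (Real.exp_pos _).le) (M := 1) fun y hy => Real.exp_le_one_iff.2 (by linarith)
  generalize Pr.map (weightedSum l n P) = μ at *
  have hI : Integrable (fun w => Real.exp (-w)) μ := by
    refine Integrable.of_bound (by fun_prop) 1 ?_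
    filter_upwards [hnn] with w hw
    rw [Real.norm_of_nonneg (Real.exp_pos _).le, Real.exp_le_one_iff]
    linarith
  simp only [sub_mul]
  rw [integral_sub h1 (hI.const_mul _), h2, integral_const_mul,
    mul_sub (θ * ∫ w, Real.exp (-w) ∂μ), Finset.mul_sum]
  congr 1
  · refine Finset.sum_congr rfl fun k _ => ?_
    have : ∀ w : ℝ, Real.exp (-(w + k / n)) = Real.exp (-w) * Real.exp (-(k / n : ℝ)) := fun w => by
      rw [← Real.exp_add]
      congr 1
      ring
    simp only [this]
    rw [integral_mul_const]
    ring
  · ring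

/-- Jensen's inequality, in the form of the tangent to `e^(-w)` at `θ/b`, together with the mean
bound `E W ≤ θ/b`. -/
theorem exp_neg_le_integral_exp_neg (h : IsPoissonFamily Pr θ β l n P) [IsProbabilityMeasure Pr]
    (hθ : 0 < θ) (hβ : -β < (l : ℝ)) (hl : 1 ≤ l) (hln : l ≤ n) {b : ℝ} (hb : 0 < b)
    (hbk : ∀ k : ℕ, l ≤ k → b * k ≤ k + β) :
    Real.exp (-(θ / b)) ≤ ∫ w, Real.exp (-w) ∂(Pr.map (weightedSum l n P)) := by
  have := h.isProbabilityMeasure_map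
  have hnn := h.ae_nonneg
  have hid := h.integrable_id hθ hβ
  have h2 := (h.integrable_integral_mul hθ hβ (f := fun _ => 1) measurable_const
    (fun _ => zero_le_one) (M := 1) fun _ _ => le_rfl).2
  generalize Pr.map (weightedSum l n P) = μ at *
  have hn0 : (0 : ℝ) < n := by exact_mod_cast hl.trans hln
  have hmean : ∫ w, w ∂μ ≤ θ / b := by
    simp only [mul_one, integral_const, probReal_univ, smul_eq_mul] at h2
    rw [h2]
    calc ∑ k ∈ Finset.Icc l n, (k / n : ℝ) * (θ / (k + β))
        ≤ ∑ k ∈ Finset.Icc l n, θ / b / n := by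
          refine Finset.sum_le_sum fun k hk => ?_
          have hlk : l ≤ k := (Finset.mem_Icc.1 hk).1
          have hk0 : (0 : ℝ) < k := by exact_mod_cast hl.trans hlk
          have hkb := hbk k hlk
          calc (k / n : ℝ) * (θ / (k + β)) ≤ (k / n : ℝ) * (θ / (b * k)) := by gcongr
            _ = θ / b / n := by field_simp
      _ ≤ ∑ k ∈ Finset.Icc 1 n, θ / b / n :=
          Finset.sum_le_sum_of_subset_of_nonneg (Finset.Icc_subset_Icc_left hl)
            fun _ _ _ => by positivity
      _ = θ / b := by
          rw [Finset.sum_const, Nat.card_Icc, Nat.add_sub_cancel, nsmul_eq_mul]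
          field_simp
  have hI : Integrable (fun w => Real.exp (-w)) μ := by
    refine Integrable.of_bound (by fun_prop) 1 ?_
    filter_upwards [hnn] with w hw
    rw [Real.norm_of_nonneg (Real.exp_pos _).le, Real.exp_le_one_iff]
    linarith
  have hlin : Integrable (fun w => Real.exp (-(θ / b)) * (1 + θ / b - w)) μ :=
    ((integrable_const _).sub hid).const_mul _
  calc Real.exp (-(θ / b)) ≤ Real.exp (-(θ / b)) * (1 + θ / b - ∫ w, w ∂μ) :=
        le_mul_of_one_le_right (Real.exp_pos _).le (by linarith)
    _ = ∫ w, Real.exp (-(θ / b)) * (1 + θ / b - w) ∂μ := by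
        rw [integral_const_mul, integral_sub (integrable_const _) hid]
        simp
    _ ≤ ∫ w, Real.exp (-w) ∂μ := by
        refine integral_mono hlin hI fun w => ?_
        have h1 := Real.add_one_le_exp (θ / b - w)
        have h3 : Real.exp (-w) = Real.exp (-(θ / b)) * Real.exp (θ / b - w) := by
          rw [← Real.exp_add]
          congr 1
          ring
        simp only
        rw [h3]
        gcongr
        linarith

end IsPoissonFamily

/-- Evaluation at `a = 0`: the Poisson sum has an atom there, the Dickman law has none. -/
theorem exists_div_rpow_le_kolmogorovDist {θ β : ℝ} (hθ : 0 < θ) {l : ℕ} (hl : 1 ≤ l)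
    (hβ : -β < (l : ℝ)) : ∃ c : ℝ, 0 < c ∧ ∀ n : ℕ, l ≤ n →
      ∀ (Ω : Type*) [MeasurableSpace Ω] (Pr : Measure Ω) [IsProbabilityMeasure Pr]
        (P : ℕ → Ω → ℕ), IsPoissonFamily Pr θ β l n P →
        c / (n : ℝ) ^ θ ≤ kolmogorovDist (Pr.map (weightedSum l n P)) (dickman θ) := by
  obtain ⟨b, hb, hbk⟩ := exists_mul_le_add β
  obtain ⟨A, hA⟩ : ∃ A, A = |β| / b * ∑' k : ℕ, ((k : ℝ) ^ 2)⁻¹ := ⟨_, rfl⟩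
  refine ⟨Real.exp (-(θ * (1 + A))), Real.exp_pos _, fun n hln Ω _ Pr _ P h => ?_⟩
  have := h.isProbabilityMeasure_map
  have hD := isDickman_dickman hθ
  have := hD.isProbabilityMeasure
  have hn0 : (0 : ℝ) < n := by exact_mod_cast hl.trans hln
  have hl0 : (0 : ℝ) < l := by exact_mod_cast hl
  have hl1 : (1 : ℝ) ≤ l := by exact_mod_cast hl
  have hdist := abs_measureReal_Iic_sub_le_kolmogorovDist (Pr.map (weightedSum l n P))
    (dickman θ) le_rfl
  rw [hD.measureReal_Iic_zero hθ, sub_zero, abs_of_nonneg measureReal_nonneg] at hdist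
  refine le_trans ?_ ((h.measureReal_Iic_zero hθ hβ).trans hdist)
  have h1 := sum_Icc_inv_le_log hl hln
  have h2 := (abs_le.1 (abs_sum_inv_add_sub_le hb hl (fun k hk => hbk l k hl hβ hk) le_rfl
    (n := n))).2
  rw [← hA] at h2
  have h3 : ∑ k ∈ Finset.Icc l n, θ / (k + β) = θ * ∑ k ∈ Finset.Icc l n, ((k : ℝ) + β)⁻¹ := by
    rw [Finset.mul_sum]
    exact Finset.sum_congr rfl fun k _ => div_eq_mul_inv _ _
  have h4 : Real.log (n / l) ≤ Real.log n :=
    Real.log_le_log (by positivity) (div_le_self hn0.le hl1)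
  rw [h3, Real.rpow_def_of_pos hn0, ← Real.exp_sub, Real.exp_le_exp]
  nlinarith

/-- For `β ≠ 0` the `β`-term has size at least of order `|β| log n / n`, since `e^(-k/n) ≥ e^(-1)`,
and beats the `O(l/n)` Riemann error once `log n` is large. For `β = 0` the Riemann error itself is
bounded below. -/
theorem exists_weighted_exp_sum_lower_bound (β : ℝ) {l : ℕ} (hl : 1 ≤ l) (hβ : -β < (l : ℝ)) :
    ∃ c N : ℝ, 0 < c ∧ ∀ n : ℕ, l ≤ n → N < Real.log n →
      c * ((1 + |β| * Real.log n) / n) ≤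
        |∑ k ∈ Finset.Icc l n, (k / n : ℝ) * ((k : ℝ) + β)⁻¹ * Real.exp (-(k / n : ℝ)) -
          (1 - Real.exp (-1))| := by
  have hl1 : (1 : ℝ) ≤ l := by exact_mod_cast hl
  have hsplit : ∀ n : ℕ, l ≤ n → ∑ k ∈ Finset.Icc 1 n, Real.exp (-(k / n : ℝ)) =
      ∑ k ∈ Finset.Ico 1 l, Real.exp (-(k / n : ℝ)) +
      ∑ k ∈ Finset.Icc l n, Real.exp (-(k / n : ℝ)) := fun n hln =>
    (Finset.sum_Ico_consecutive _ hl (by lia : l ≤ n + 1)).symm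
  have hE : 0 < 1 - Real.exp (-1) := by
    have := Real.exp_lt_one_iff.2 (by norm_num : (-1 : ℝ) < 0)
    linarith
  rcases eq_or_ne β 0 with rfl | hβ0
  -- Any negative threshold excludes no `n`, as `log n ≥ 0`.
  · refine ⟨(1 - Real.exp (-1)) / 3, -1, by positivity, fun n hln _ => ?_⟩
    have hn0 : (0 : ℝ) < n := by exact_mod_cast hl.trans hln
    have h1 := sum_exp_neg_div_le (hl.trans hln)
    have h2 : ∑ k ∈ Finset.Icc l n, (k / n : ℝ) * ((k : ℝ) + 0)⁻¹ * Real.exp (-(k / n : ℝ)) =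
        (n : ℝ)⁻¹ * ∑ k ∈ Finset.Icc l n, Real.exp (-(k / n : ℝ)) := by
      rw [Finset.mul_sum]
      refine Finset.sum_congr rfl fun k hk => ?_
      have hk0 : (0 : ℝ) < k := by exact_mod_cast hl.trans (Finset.mem_Icc.1 hk).1
      rw [add_zero]
      field_simp
    have h3 : 0 ≤ (n : ℝ)⁻¹ * ∑ k ∈ Finset.Ico 1 l, Real.exp (-(k / n : ℝ)) :=
      mul_nonneg (by positivity) (Finset.sum_nonneg fun _ _ => (Real.exp_pos _).le)
    rw [hsplit n hln, mul_add] at h1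
    have h4 : (1 - Real.exp (-1)) / 3 * ((1 + |(0 : ℝ)| * Real.log n) / n) =
        (1 - Real.exp (-1)) * (1 / (3 * n)) := by
      rw [abs_zero]
      field_simp
      ring
    rw [h2, h4, abs_sub_comm]
    refine le_trans ?_ (le_abs_self _)
    linarith
  · obtain ⟨b, hb, hbk⟩ := exists_mul_le_add β
    obtain ⟨A, hA⟩ : ∃ A, A = |β| / b * ∑' k : ℕ, ((k : ℝ) ^ 2)⁻¹ := ⟨_, rfl⟩
    have hA0 : 0 ≤ A := by rw [hA]; positivity
    have hβpos : 0 < |β| := abs_pos.2 hβ0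
    obtain ⟨e, he⟩ : ∃ e, e = Real.exp (-1) := ⟨_, rfl⟩
    have he0 : 0 < e := by rw [he]; exact Real.exp_pos _
    have hlogl : 0 ≤ Real.log l := Real.log_nonneg hl1
    obtain ⟨B, hB⟩ : ∃ B, B = |β| * e * (Real.log l + A) + l := ⟨_, rfl⟩
    have hB1 : 1 ≤ B := by
      rw [hB]
      have : 0 ≤ |β| * e * (Real.log l + A) := by positivity
      linarith
    -- Beyond this threshold `B` is less than half of the main term `|β| e log n`.
    refine ⟨e / 4, 2 * B / (|β| * e), by positivity, fun n hln hN => ?_⟩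
    have hn0 : (0 : ℝ) < n := by exact_mod_cast hl.trans hln
    have hi : 0 < (n : ℝ)⁻¹ := by positivity
    rw [div_lt_iff₀ (by positivity)] at hN
    rw [← he] at hE ⊢
    have hanti : Antitone fun u : ℝ => Real.exp (-u) := fun u v huv =>
      Real.exp_le_exp.2 (neg_le_neg huv)
    obtain ⟨r1, r2⟩ := hanti.riemann_sum_bounds (hl.trans hln)
    have hint : ∫ u in (0 : ℝ)..1, Real.exp (-u) = 1 - e := by
      rw [intervalIntegral.integral_comp_neg (fun u => Real.exp u), integral_exp, neg_zero,
        Real.exp_zero, he]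
    rw [hint, hsplit n hln] at r1 r2
    simp only [neg_zero, Real.exp_zero] at r2
    rw [← he] at r2
    have hs0 : 0 ≤ ∑ k ∈ Finset.Ico 1 l, Real.exp (-(k / n : ℝ)) :=
      Finset.sum_nonneg fun _ _ => (Real.exp_pos _).le
    have hs1 : ∑ k ∈ Finset.Ico 1 l, Real.exp (-(k / n : ℝ)) ≤ l - 1 := by
      refine (Finset.sum_le_card_nsmul _ _ 1 fun k _ => ?_).trans (le_of_eq ?_)
      · rw [Real.exp_le_one_iff]
        have : (0 : ℝ) ≤ k / n := by positivity
        linarith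
      · rw [Nat.card_Ico, nsmul_eq_mul, Nat.cast_sub hl, Nat.cast_one, mul_one]
    obtain ⟨S, hS⟩ : ∃ S, S = ∑ k ∈ Finset.Icc l n, Real.exp (-(k / n : ℝ)) := ⟨_, rfl⟩
    obtain ⟨T, hT⟩ : ∃ T, T = ∑ k ∈ Finset.Icc l n, ((k : ℝ) + β)⁻¹ * Real.exp (-(k / n : ℝ)) :=
      ⟨_, rfl⟩
    have hsum : ∑ k ∈ Finset.Icc l n, (k / n : ℝ) * ((k : ℝ) + β)⁻¹ * Real.exp (-(k / n : ℝ)) =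
        (n : ℝ)⁻¹ * S - (n : ℝ)⁻¹ * (β * T) := by
      rw [hS, hT, Finset.mul_sum, Finset.mul_sum, Finset.mul_sum, ← Finset.sum_sub_distrib]
      refine Finset.sum_congr rfl fun k hk => ?_
      have hlk : l ≤ k := (Finset.mem_Icc.1 hk).1
      have hk0 : (0 : ℝ) < k := by exact_mod_cast hl.trans hlk
      have hkβ : 0 < (k : ℝ) + β := lt_of_lt_of_le (by positivity) (hbk l k hl hβ hlk)
      field_simp
      ring
    have hTge : e * (Real.log n - Real.log l - A) ≤ T := by
      have h1 := log_le_sum_Icc_inv hl (by lia : l ≤ n + 1)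
      have h2 := (abs_le.1 (abs_sum_inv_add_sub_le hb hl (fun k hk => hbk l k hl hβ hk) le_rfl
        (n := n))).1
      rw [← hA] at h2
      have h3 : Real.log n - Real.log l ≤ Real.log ((n + 1) / l) := by
        rw [← Real.log_div hn0.ne' (by positivity)]
        refine Real.log_le_log (by positivity) ?_
        gcongr
        linarith
      calc e * (Real.log n - Real.log l - A) ≤ e * ∑ k ∈ Finset.Icc l n, ((k : ℝ) + β)⁻¹ := by
            gcongr
            linarith
        _ ≤ T := by
            rw [hT, Finset.mul_sum]
            refine Finset.sum_le_sum fun k hk => ?_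
            obtain ⟨hlk, hkn⟩ := Finset.mem_Icc.1 hk
            have hk0 : (0 : ℝ) < k := by exact_mod_cast hl.trans hlk
            have hkβ : 0 < (k : ℝ) + β := lt_of_lt_of_le (by positivity) (hbk l k hl hβ hlk)
            rw [mul_comm, he]
            gcongr
            exact (div_le_one hn0).2 (by exact_mod_cast hkn)
    have hR : |(n : ℝ)⁻¹ * S - (1 - e)| ≤ (n : ℝ)⁻¹ * l := by
      rw [← hS] at r1 r2
      rw [mul_sub, mul_add, mul_add, mul_one] at r2
      rw [mul_add] at r1
      have a1 := mul_le_mul_of_nonneg_left hs1 hi.le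
      have a2 := mul_nonneg hi.le hs0
      have a3 := mul_nonneg hi.le he0.le
      have a4 := mul_le_mul_of_nonneg_left hl1 hi.le
      rw [mul_sub, mul_one] at a1
      rw [mul_one] at a4
      rw [abs_le]
      constructor <;> linarith
    have hT0 : |(n : ℝ)⁻¹ * (β * T)| ≥ (n : ℝ)⁻¹ * (|β| * (e * (Real.log n - Real.log l - A))) := by
      rw [abs_mul, abs_mul, abs_of_pos hi]
      gcongr
      exact hTge.trans (le_abs_self T)
    rw [hsum]
    have htri : |(n : ℝ)⁻¹ * (β * T)| - |(n : ℝ)⁻¹ * S - (1 - e)| ≤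
        |(n : ℝ)⁻¹ * S - (n : ℝ)⁻¹ * (β * T) - (1 - e)| := by
      rw [show (n : ℝ)⁻¹ * S - (n : ℝ)⁻¹ * (β * T) - (1 - e) =
        ((n : ℝ)⁻¹ * S - (1 - e)) - (n : ℝ)⁻¹ * (β * T) by ring, abs_sub_comm (_ - _ : ℝ)]
      exact abs_sub_abs_le_abs_sub _ _
    refine le_trans ?_ htri
    have hfin : e / 4 * ((1 + |β| * Real.log n) / n) ≤
        (n : ℝ)⁻¹ * (|β| * (e * (Real.log n - Real.log l - A))) - (n : ℝ)⁻¹ * l := by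
      rw [← mul_sub, show e / 4 * ((1 + |β| * Real.log n) / n) =
        (n : ℝ)⁻¹ * (e / 4 * (1 + |β| * Real.log n)) by ring]
      refine mul_le_mul_of_nonneg_left ?_ hi.le
      have he1 : e ≤ 1 := by linarith
      nlinarith
    linarith

/-- For large `n` the test function decides. In the remaining range `log n ≤ N`, both `n^θ` and the
target rate are bounded, so the atom at `0` gives a sufficient constant lower bound. -/
theorem exists_lower_bound_of_pos {θ β : ℝ} (hθ : 0 < θ) {l : ℕ} (hl : 1 ≤ l)
    (hβ : -β < (l : ℝ)) : ∃ C' : ℝ, 0 < C' ∧ ∀ n : ℕ, l ≤ n →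
      ∀ (Ω : Type*) [MeasurableSpace Ω] (Pr : Measure Ω) [IsProbabilityMeasure Pr]
        (P : ℕ → Ω → ℕ), IsPoissonFamily Pr θ β l n P →
        C' * ((1 + |β| * Real.log (n : ℝ)) / (n : ℝ)) ≤
          kolmogorovDist (Pr.map (weightedSum l n P)) (dickman θ) := by
  obtain ⟨b, hb, hbk⟩ := exists_mul_le_add β
  obtain ⟨L, hL, hLb⟩ := exists_kolmogorovDist_ge hθ
  obtain ⟨c₀, hc₀, hatom⟩ := exists_div_rpow_le_kolmogorovDist hθ hl hβ
  obtain ⟨c, N, hc, hlarge⟩ := exists_weighted_exp_sum_lower_bound β hl hβ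
  obtain ⟨D, hD⟩ : ∃ D, D = 1 + |β| * |N| := ⟨_, rfl⟩
  have hD0 : 0 < D := by rw [hD]; positivity
  obtain ⟨C₁, hC₁⟩ : ∃ C₁, C₁ = θ * Real.exp (-(θ / b)) * c / L := ⟨_, rfl⟩
  obtain ⟨C₂, hC₂⟩ : ∃ C₂, C₂ = c₀ / Real.exp (N * θ) / D := ⟨_, rfl⟩
  have hC₁0 : 0 < C₁ := by rw [hC₁]; positivity
  have hC₂0 : 0 < C₂ := by rw [hC₂]; positivity
  refine ⟨min C₁ C₂, lt_min hC₁0 hC₂0, fun n hln Ω _ Pr _ P h => ?_⟩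
  have := h.isProbabilityMeasure_map
  have hn1 : (1 : ℝ) ≤ n := by exact_mod_cast hl.trans hln
  have hn0 : (0 : ℝ) < n := by linarith
  have hlog : 0 ≤ Real.log n := Real.log_nonneg hn1
  have hterm : 0 ≤ (1 + |β| * Real.log (n : ℝ)) / (n : ℝ) := by positivity
  rcases lt_or_ge N (Real.log n) with hN | hN
  · refine (mul_le_mul_of_nonneg_right (min_le_left _ _) hterm).trans ?_
    have h1 := hLb _ h.ae_nonneg
    rw [h.integral_sub_mul_exp_neg hθ hβ, abs_mul] at h1
    have h2 := h.exp_neg_le_integral_exp_neg hθ hβ hl hln hb fun k hk => hbk l k hl hβ hk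
    have h3 := hlarge n hln hN
    have h4 : θ * Real.exp (-(θ / b)) ≤
        |θ * ∫ w, Real.exp (-w) ∂(Pr.map (weightedSum l n P))| := by
      refine le_trans ?_ (le_abs_self _)
      gcongr
    rw [hC₁, div_mul_eq_mul_div, div_le_iff₀ hL, mul_comm _ L, mul_assoc _ c]
    refine le_trans ?_ h1
    exact mul_le_mul h4 h3 (by positivity) (abs_nonneg _)
  · refine (mul_le_mul_of_nonneg_right (min_le_right _ _) hterm).trans ?_
    refine le_trans ?_ (hatom n hln Ω Pr P h)
    have h1 : (1 + |β| * Real.log (n : ℝ)) / (n : ℝ) ≤ D := by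
      rw [hD]
      refine (div_le_self (by positivity) hn1).trans ?_
      gcongr
      exact hN.trans (le_abs_self N)
    have h2 : (n : ℝ) ^ θ ≤ Real.exp (N * θ) := by
      rw [Real.rpow_def_of_pos hn0]
      gcongr
    calc C₂ * ((1 + |β| * Real.log (n : ℝ)) / (n : ℝ)) ≤ C₂ * D := by gcongr
      _ = c₀ / Real.exp (N * θ) := by
          rw [hC₂]
          field_simp
      _ ≤ c₀ / (n : ℝ) ^ θ := by gcongr

theorem theorem1p4 (θ β : ℝ) (hθ : 0 < θ) :
    -- the upper bound, with a constant depending only on `θ` and `β`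
    (∃ C : ℝ, 0 < C ∧
      ∀ l n : ℕ, 1 ≤ l → -β < (l : ℝ) → l ≤ n →
        ∀ (Ω : Type*) [MeasurableSpace Ω] (Pr : Measure Ω) [IsProbabilityMeasure Pr]
          (P : ℕ → Ω → ℕ), IsPoissonFamily Pr θ β l n P →
          kolmogorovDist (Pr.map (weightedSum l n P)) (dickman θ) ≤
            if 1 ≤ θ then C * (((l : ℝ) + |β| * Real.log ((n : ℝ) / (l : ℝ))) / (n : ℝ))
            else C * (l : ℝ) ^ θ / (n : ℝ) ^ θ) ∧
    -- the optimality in `n`, with a constant depending only on `θ`, `β` and `l`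
    (∀ l : ℕ, 1 ≤ l → -β < (l : ℝ) →
      ∃ C' : ℝ, 0 < C' ∧
        ∀ n : ℕ, l ≤ n →
          ∀ (Ω : Type*) [MeasurableSpace Ω] (Pr : Measure Ω) [IsProbabilityMeasure Pr]
            (P : ℕ → Ω → ℕ), IsPoissonFamily Pr θ β l n P →
            (if 1 ≤ θ then C' * ((1 + |β| * Real.log (n : ℝ)) / (n : ℝ))
              else C' / (n : ℝ) ^ θ) ≤
              kolmogorovDist (Pr.map (weightedSum l n P)) (dickman θ)) := by
  by_cases h1 : 1 ≤ θ
  · simp only [if_pos h1]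
    exact ⟨exists_upper_bound_of_one_le β h1, fun l hl hβ => exists_lower_bound_of_pos hθ hl hβ⟩
  · simp only [if_neg h1]
    exact ⟨exists_upper_bound_of_lt_one β hθ (not_le.1 h1),
      fun l hl hβ => exists_div_rpow_le_kolmogorovDist hθ hl hβ⟩
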